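/- Let $R(\mathbb{R}^3)$ denote the Rollnik class, i.e. the set of all $V\in L^1_{\mathrm{loc}}(\mathbb{R}^3;\mathbb{C})$ such that $$\|V\|_{R(\mathbb{R}^3)}^2:=\iint_{\mathbb{R}^3\times\mathbb{R}^3}\frac{|V(x)|\,|V(y)|}{|x-y|^2}\,dx\,dy<\infty .$$ For $V\in R(\mathbb{R}^3)$ let $H_V=\Delta^2\dotplus V$ be the biharmonic operator in $L^2(\mathbb{R}^3)$ defined as a form sum: let $$h_V(\varphi,\psi):=\int_{\mathbb{R}^3}\overline{\Delta\varphi}\,\Delta\psi\,dx+\int_{\mathbb{R}^3}\overline{\varphi}\,V\,\psi\,dx,\qquad \mathrm{Dom}(h_V):=\Big\{\psi\in H^2(\mathbb{R}^3):\int_{\mathbb{R}^3}|V||\psi|^2\,dx<\infty\Big\},$$ (for $V\in R(\mathbb{R}^3)$ one has $\mathrm{Dom}(h_V)=H^2(\mathbb{R}^3)$), and let $\mathrm{Dom}(H_V)$ consist of those $\psi\in\mathrm{Dom}(h_V)$ for which there is $\eta\in L^2(\mathbb{R}^3)$ with $h_V(\varphi,\psi)=(\varphi,\eta)_{L^2(\mathbb{R}^3)}$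 for all $\varphi\in\mathrm{Dom}(h_V)$; then $H_V\psi:=\eta$. **Theorem.** Let $V\in R(\mathbb{R}^3)$. Then the point spectrum (the set of all eigenvalues) of $H_V$, including eigenvalues embedded in $[0,\infty)$, satisfies $$\sigma_{\mathrm p}(H_V)\subset\Big\{\lambda\in\mathbb{C}:\ |\lambda|\le\frac12\,\frac{\|V\|_{R(\mathbb{R}^3)}^2}{(4\pi)^2}\Big\}.$$ -/

import Mathlib

open MeasureTheory
open scoped ENNReal SchwartzMap Laplacian ComplexConjugate

noncomputable section

/-- Euclidean space `ℝ³`. -/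
abbrev R3 : Type := EuclideanSpace ℝ (Fin 3)

/-- The Hilbert space `L²(ℝ³; ℂ)`. -/
abbrev L2R3 : Type := Lp ℂ 2 (volume : Measure R3)

/-! ### The Rollnik class -/

/-- The double integral `∬ |V(x)| |V(y)| / |x - y|² dx dy`, with values in `[0, ∞]`. -/
def rollnikIntegral (V : R3 → ℂ) : ℝ≥0∞ :=
  ∫⁻ x, ∫⁻ y, ‖V x‖ₑ * ‖V y‖ₑ / ‖x - y‖ₑ ^ 2

/-- The Rollnik class `R(ℝ³)`: complex-valued locally integrable functions with a finite
Rollnik integral. -/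
structure MemRollnik (V : R3 → ℂ) : Prop where
  locallyIntegrable : LocallyIntegrable V volume
  integral_lt_top : rollnikIntegral V < ∞

/-- The Rollnik norm, the square root of the Rollnik integral. -/
def rollnikNorm (V : R3 → ℂ) : ℝ := Real.sqrt (rollnikIntegral V).toReal

/-! ### The Sobolev space `H²(ℝ³)` and the Laplacian on it -/

/-- The Sobolev space `H²(ℝ³)` as a subspace of `L²(ℝ³)`. -/
def sobolevH2 : Submodule ℂ L2R3 where
  carrier := {ψ | TemperedDistribution.MemSobolev 2 2 (ψ : 𝓢'(R3, ℂ))}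
  add_mem' := by
    intro f g hf hg
    have h := TemperedDistribution.MemSobolev.add hf hg
    simpa only [Set.mem_ofPred_eq, ← Lp.toTemperedDistributionCLM_apply, map_add] using h
  zero_mem' := by
    have h := TemperedDistribution.memSobolev_fun_zero R3 ℂ 2 2
    simpa only [Set.mem_ofPred_eq, ← Lp.toTemperedDistributionCLM_apply, map_zero] using h
  smul_mem' := by
    intro c f hf
    have h := TemperedDistribution.MemSobolev.smul c hf
    simpa only [Set.mem_ofPred_eq, ← Lp.toTemperedDistributionCLM_apply, map_smul] using h

theorem mem_sobolevH2 {ψ : L2R3} :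
    ψ ∈ sobolevH2 ↔ TemperedDistribution.MemSobolev 2 2 (ψ : 𝓢'(R3, ℂ)) := Iff.rfl

theorem toTemperedDistribution_injective_L2R3 :
    Function.Injective (Lp.toTemperedDistributionCLM ℂ (volume : Measure R3) 2) :=
  LinearMap.ker_eq_bot.mp
    (Lp.ker_toTemperedDistributionCLM_eq_bot (F := ℂ) (μ := (volume : Measure R3)) (p := 2))

theorem exists_laplacian_eq (ψ : sobolevH2) :
    ∃ g : L2R3, Δ ((ψ : L2R3) : 𝓢'(R3, ℂ)) = (g : 𝓢'(R3, ℂ)) := by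
  have h := TemperedDistribution.MemSobolev.laplacian (mem_sobolevH2.mp ψ.2)
  rw [sub_self] at h
  exact TemperedDistribution.memSobolev_zero_iff.mp h

/-- The distributional Laplacian `Δ : H²(ℝ³) → L²(ℝ³)`. -/
def laplacianH2 : sobolevH2 →ₗ[ℂ] L2R3 where
  toFun ψ := (exists_laplacian_eq ψ).choose
  map_add' f g := by
    apply toTemperedDistribution_injective_L2R3
    rw [map_add]
    simp only [Lp.toTemperedDistributionCLM_apply]
    rw [← (exists_laplacian_eq (f + g)).choose_spec, ← (exists_laplacian_eq f).choose_spec,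
      ← (exists_laplacian_eq g).choose_spec]
    simp only [← TemperedDistribution.laplacianCLM_apply, ← map_add,
      ← Lp.toTemperedDistributionCLM_apply, Submodule.coe_add]
  map_smul' c f := by
    apply toTemperedDistribution_injective_L2R3
    rw [map_smul]
    simp only [Lp.toTemperedDistributionCLM_apply, RingHom.id_apply]
    rw [← (exists_laplacian_eq (c • f)).choose_spec, ← (exists_laplacian_eq f).choose_spec]
    simp only [← TemperedDistribution.laplacianCLM_apply, ← map_smul,
      ← Lp.toTemperedDistributionCLM_apply, Submodule.coe_smul]

/-- `laplacianH2 ψ` is the `L²` function that represents the distribution `Δψ`. -/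
theorem laplacianH2_spec (ψ : sobolevH2) :
    Δ ((ψ : L2R3) : 𝓢'(R3, ℂ)) = (laplacianH2 ψ : 𝓢'(R3, ℂ)) :=
  (exists_laplacian_eq ψ).choose_spec

/-! ### The forms `h₀`, `v` and `h_V = h₀ + v` -/

theorem integrable_conj_mul_mul {V : R3 → ℂ} (hV : LocallyIntegrable V volume) {φ ψ : L2R3}
    (hφ : ∫⁻ x, ‖V x‖ₑ * ‖φ x‖ₑ ^ 2 < ∞) (hψ : ∫⁻ x, ‖V x‖ₑ * ‖ψ x‖ₑ ^ 2 < ∞) :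
    Integrable (fun x ↦ conj (φ x) * V x * ψ x) volume := by
  have hVm := hV.aestronglyMeasurable
  have hφm := (Lp.memLp φ).aestronglyMeasurable
  have hψm := (Lp.memLp ψ).aestronglyMeasurable
  refine ⟨((Complex.continuous_conj.comp_aestronglyMeasurable hφm).mul hVm).mul hψm, ?_⟩
  refine lt_of_le_of_lt ?_ (ENNReal.add_lt_top.mpr ⟨hφ, hψ⟩)
  have hm : AEMeasurable (fun x ↦ ‖V x‖ₑ * ‖φ x‖ₑ ^ 2) := hVm.enorm.mul (hφm.enorm.pow_const 2)
  rw [← lintegral_add_left' hm]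
  refine lintegral_mono fun x ↦ ?_
  simp only [enorm_mul, RCLike.enorm_conj]
  calc ‖φ x‖ₑ * ‖V x‖ₑ * ‖ψ x‖ₑ = ‖V x‖ₑ * (‖φ x‖ₑ * ‖ψ x‖ₑ) := by ring
    _ ≤ ‖V x‖ₑ * (‖φ x‖ₑ ^ 2 + ‖ψ x‖ₑ ^ 2) := by
      gcongr
      rcases le_total (‖φ x‖ₑ) (‖ψ x‖ₑ) with h | h
      · calc ‖φ x‖ₑ * ‖ψ x‖ₑ ≤ ‖ψ x‖ₑ * ‖ψ x‖ₑ := by gcongr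
          _ = ‖ψ x‖ₑ ^ 2 := (sq _).symm
          _ ≤ _ := le_add_self
      · calc ‖φ x‖ₑ * ‖ψ x‖ₑ ≤ ‖φ x‖ₑ * ‖φ x‖ₑ := by gcongr
          _ = ‖φ x‖ₑ ^ 2 := (sq _).symm
          _ ≤ _ := le_self_add
    _ = _ := by ring

/-- The domain of the form `v[ψ] = ∫ V |ψ|²`: all `ψ ∈ L²(ℝ³)` with `∫ |V| |ψ|² < ∞`. -/
def potentialFormDomain (V : R3 → ℂ) (hV : LocallyIntegrable V volume) : Submodule ℂ L2R3 where
  carrier := {ψ | ∫⁻ x, ‖V x‖ₑ * ‖ψ x‖ₑ ^ 2 < ∞}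
  add_mem' := by
    intro f g hf hg
    simp only [Set.mem_ofPred_eq] at hf hg ⊢
    have hVm := hV.aestronglyMeasurable
    have hfm := (Lp.memLp f).aestronglyMeasurable
    have hm : AEMeasurable (fun x ↦ 2 * (‖V x‖ₑ * ‖f x‖ₑ ^ 2)) :=
      (hVm.enorm.mul (hfm.enorm.pow_const 2)).const_mul 2
    refine lt_of_le_of_lt (b := ∫⁻ x, (2 * (‖V x‖ₑ * ‖f x‖ₑ ^ 2) + 2 * (‖V x‖ₑ * ‖g x‖ₑ ^ 2))) ?_ ?_
    · refine lintegral_mono_ae ?_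
      filter_upwards [Lp.coeFn_add f g] with x hx
      rw [hx, Pi.add_apply]
      have h1 : ‖f x + g x‖ₑ ^ 2 ≤ 2 * ‖f x‖ₑ ^ 2 + 2 * ‖g x‖ₑ ^ 2 := by
        have hr : ‖f x + g x‖ ^ 2 ≤ 2 * ‖f x‖ ^ 2 + 2 * ‖g x‖ ^ 2 := by
          have := norm_add_le (f x) (g x)
          nlinarith [sq_nonneg (‖f x‖ - ‖g x‖), norm_nonneg (f x + g x)]
        have hr' : ‖f x + g x‖₊ ^ 2 ≤ 2 * ‖f x‖₊ ^ 2 + 2 * ‖g x‖₊ ^ 2 := by exact_mod_cast hr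
        simp only [enorm_eq_nnnorm]
        exact_mod_cast hr'
      calc ‖V x‖ₑ * ‖f x + g x‖ₑ ^ 2 ≤ ‖V x‖ₑ * (2 * ‖f x‖ₑ ^ 2 + 2 * ‖g x‖ₑ ^ 2) := by gcongr
        _ = _ := by ring
    · rw [lintegral_add_left' hm, lintegral_const_mul' _ _ (by simp),
        lintegral_const_mul' _ _ (by simp)]
      exact ENNReal.add_lt_top.mpr
        ⟨ENNReal.mul_lt_top (by simp) hf, ENNReal.mul_lt_top (by simp) hg⟩
  zero_mem' := by
    have h : ∫⁻ x, ‖V x‖ₑ * ‖(0 : L2R3) x‖ₑ ^ 2 = ∫⁻ _ : R3, 0 := by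
      refine lintegral_congr_ae ?_
      filter_upwards [Lp.coeFn_zero ℂ 2 (volume : Measure R3)] with x hx
      rw [hx]
      simp
    simp only [Set.mem_ofPred_eq, h, lintegral_zero, ENNReal.zero_lt_top]
  smul_mem' := by
    intro c f hf
    simp only [Set.mem_ofPred_eq] at hf ⊢
    have h : ∫⁻ x, ‖V x‖ₑ * ‖(c • f : L2R3) x‖ₑ ^ 2
        = ∫⁻ x, ‖c‖ₑ ^ 2 * (‖V x‖ₑ * ‖f x‖ₑ ^ 2) := by
      refine lintegral_congr_ae ?_
      filter_upwards [Lp.coeFn_smul c f] with x hx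
      rw [hx, Pi.smul_apply, enorm_smul]
      ring
    rw [h, lintegral_const_mul' _ _ (by simp)]
    exact ENNReal.mul_lt_top (by simp) hf

/-- The domain `Dom(h₀) ∩ Dom(v) = H²(ℝ³) ∩ Dom(v)` of the form sum `h_V = h₀ + v`. -/
def formDomain (V : R3 → ℂ) (hV : LocallyIntegrable V volume) : Submodule ℂ L2R3 :=
  sobolevH2 ⊓ potentialFormDomain V hV

/-- The sesquilinear form `h₀(φ, ψ) = ∫ conj(Δφ) Δψ` on `H²(ℝ³)`. -/
def biharmonicForm (φ ψ : sobolevH2) : ℂ :=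
  inner ℂ (laplacianH2 φ) (laplacianH2 ψ)

/-- The sesquilinear form `v(φ, ψ) = ∫ conj(φ) V ψ`. -/
def potentialForm (V : R3 → ℂ) (φ ψ : L2R3) : ℂ :=
  ∫ x, conj (φ x) * V x * ψ x

/-- The sesquilinear form `h_V = h₀ + v`, antilinear in the first argument. -/
def perturbedForm (V : R3 → ℂ) (hV : LocallyIntegrable V volume) (φ ψ : formDomain V hV) : ℂ :=
  biharmonicForm ⟨φ, φ.2.1⟩ ⟨ψ, ψ.2.1⟩ + potentialForm V φ ψ

theorem perturbedForm_add (V : R3 → ℂ) (hV : LocallyIntegrable V volume)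
    (φ ψ₁ ψ₂ : formDomain V hV) :
    perturbedForm V hV φ (ψ₁ + ψ₂) = perturbedForm V hV φ ψ₁ + perturbedForm V hV φ ψ₂ := by
  have h1 : potentialForm V φ ((ψ₁ + ψ₂ : formDomain V hV) : L2R3)
      = potentialForm V φ ψ₁ + potentialForm V φ ψ₂ := by
    unfold potentialForm
    rw [← integral_add (integrable_conj_mul_mul hV φ.2.2 ψ₁.2.2)
      (integrable_conj_mul_mul hV φ.2.2 ψ₂.2.2)]
    refine integral_congr_ae ?_
    filter_upwards [Lp.coeFn_add (ψ₁ : L2R3) (ψ₂ : L2R3)] with x hx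
    rw [Submodule.coe_add, hx, Pi.add_apply]
    ring
  have h2 : (⟨((ψ₁ + ψ₂ : formDomain V hV) : L2R3), (ψ₁ + ψ₂).2.1⟩ : sobolevH2)
      = ⟨ψ₁, ψ₁.2.1⟩ + ⟨ψ₂, ψ₂.2.1⟩ := rfl
  unfold perturbedForm biharmonicForm
  rw [h1, h2, map_add, inner_add_right]
  ring

theorem perturbedForm_smul (V : R3 → ℂ) (hV : LocallyIntegrable V volume)
    (c : ℂ) (φ ψ : formDomain V hV) :
    perturbedForm V hV φ (c • ψ) = c * perturbedForm V hV φ ψ := by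
  have h1 : potentialForm V φ ((c • ψ : formDomain V hV) : L2R3)
      = c * potentialForm V φ ψ := by
    unfold potentialForm
    rw [← integral_const_mul]
    refine integral_congr_ae ?_
    filter_upwards [Lp.coeFn_smul c (ψ : L2R3)] with x hx
    rw [Submodule.coe_smul, hx, Pi.smul_apply, smul_eq_mul]
    ring
  have h2 : (⟨((c • ψ : formDomain V hV) : L2R3), (c • ψ).2.1⟩ : sobolevH2)
      = c • ⟨ψ, ψ.2.1⟩ := rfl
  unfold perturbedForm biharmonicForm
  rw [h1, h2, map_smul, inner_smul_right]
  ring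

/-! ### The operator `H_V` associated with the form `h_V` -/

/-- The graph of the operator associated with `h_V`: all pairs `(ψ, η)` with `ψ ∈ Dom(h_V)`
and `h_V(φ, ψ) = (φ, η)` for every `φ ∈ Dom(h_V)`. -/
def operatorGraph (V : R3 → ℂ) (hV : LocallyIntegrable V volume) :
    Submodule ℂ (L2R3 × L2R3) where
  carrier := {p | ∃ h : p.1 ∈ formDomain V hV, ∀ φ : formDomain V hV,
    perturbedForm V hV φ ⟨p.1, h⟩ = inner ℂ (φ : L2R3) p.2}
  add_mem' := by
    rintro p q ⟨hp, hp'⟩ ⟨hq, hq'⟩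
    refine ⟨Submodule.add_mem _ hp hq, fun φ ↦ ?_⟩
    have h := perturbedForm_add V hV φ ⟨p.1, hp⟩ ⟨q.1, hq⟩
    rw [hp' φ, hq' φ, ← inner_add_right] at h
    exact h
  zero_mem' := by
    refine ⟨Submodule.zero_mem _, fun φ ↦ ?_⟩
    have h := perturbedForm_smul V hV 0 φ 0
    rw [zero_smul, zero_mul] at h
    rw [Prod.snd_zero, inner_zero_right]
    exact h
  smul_mem' := by
    rintro c p ⟨hp, hp'⟩
    refine ⟨Submodule.smul_mem _ c hp, fun φ ↦ ?_⟩
    have h := perturbedForm_smul V hV c φ ⟨p.1, hp⟩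
    rw [hp' φ, ← inner_smul_right] at h
    exact h

/-- The form domain is dense in `L²(ℝ³)`, as it contains all test functions. -/
theorem dense_formDomain (V : R3 → ℂ) (hV : LocallyIntegrable V volume) :
    Dense (formDomain V hV : Set L2R3) := by
  refine (MeasureTheory.Lp.dense_hasCompactSupport_contDiff (F := ℂ)
    (μ := (volume : Measure R3)) (p := 2) (by simp)).mono ?_
  rintro f ⟨g, hfg, hg1, hg2⟩
  refine ⟨?_, ?_⟩
  · have hf : f = (hg1.toSchwartzMap hg2).toLp 2 (volume : Measure R3) := by
      refine Lp.ext (hfg.trans ?_)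
      filter_upwards [(hg1.toSchwartzMap hg2).coeFn_toLp 2 (volume : Measure R3)] with x hx
      rw [hx]
      rfl
    have h := (hg1.toSchwartzMap hg2).memSobolev (s := 2) (p := 2)
    show TemperedDistribution.MemSobolev 2 2 (f : 𝓢'(R3, ℂ))
    rw [hf, Lp.toTemperedDistribution_toLp_eq]
    exact h
  · obtain ⟨C, hC⟩ := hg2.continuous.bounded_above_of_compact_support hg1
    have hK : IsCompact (tsupport g) := hg1
    have hi : ∫⁻ x in tsupport g, ‖V x‖ₑ < ∞ := (hV.integrableOn_isCompact hK).2
    show ∫⁻ x, ‖V x‖ₑ * ‖f x‖ₑ ^ 2 < ∞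
    refine lt_of_le_of_lt (b := ∫⁻ x in tsupport g, ‖V x‖ₑ * ENNReal.ofReal C ^ 2) ?_ ?_
    · rw [← lintegral_indicator hK.isClosed.measurableSet]
      refine lintegral_mono_ae ?_
      filter_upwards [hfg] with x hx
      rw [hx]
      by_cases hxK : x ∈ tsupport g
      · rw [Set.indicator_of_mem hxK]
        gcongr
        rw [← ofReal_norm]
        exact ENNReal.ofReal_le_ofReal (hC x)
      · rw [image_eq_zero_of_notMem_tsupport hxK]
        simp
    · rw [lintegral_mul_const' _ _ (by simp)]
      exact ENNReal.mul_lt_top hi (by simp)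

/-- The graph is single-valued. -/
theorem operatorGraph_functional (V : R3 → ℂ) (hV : LocallyIntegrable V volume) :
    ∀ p ∈ operatorGraph V hV, p.1 = 0 → p.2 = 0 := by
  rintro ⟨ψ, η⟩ ⟨h, h'⟩ h0
  simp only at h0
  subst h0
  refine (dense_formDomain V hV).eq_zero_of_inner_right ℂ fun φ hφ ↦ ?_
  have h1 := perturbedForm_smul V hV 0 ⟨φ, hφ⟩ 0
  rw [zero_smul, zero_mul] at h1
  exact (h' ⟨φ, hφ⟩).symm.trans h1

/-- The biharmonic operator `H_V = Δ² ∔ V` in `L²(ℝ³)`, that is, the operator associated with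
the form `h_V`: its domain consists of the `ψ ∈ Dom(h_V)` for which there is `η ∈ L²(ℝ³)` with
`h_V(φ, ψ) = (φ, η)` for all `φ ∈ Dom(h_V)`, and then `H_V ψ = η`. -/
def biharmonicOperator (V : R3 → ℂ) (hV : LocallyIntegrable V volume) : L2R3 →ₗ.[ℂ] L2R3 :=
  (operatorGraph V hV).toLinearPMap

theorem graph_biharmonicOperator (V : R3 → ℂ) (hV : LocallyIntegrable V volume) :
    (biharmonicOperator V hV).graph = operatorGraph V hV :=
  Submodule.toLinearPMap_graph_eq _ (operatorGraph_functional V hV)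

/-- The point spectrum of an unbounded operator: the set of its eigenvalues. -/
def pointSpectrum (A : L2R3 →ₗ.[ℂ] L2R3) : Set ℂ :=
  {z | ∃ ψ : A.domain, (ψ : L2R3) ≠ 0 ∧ A ψ = z • (ψ : L2R3)}

end

noncomputable section

open Set Filter Topology
open scoped FourierTransform

/-! This is a Birman–Schwinger argument. An eigenfunction `ψ` with eigenvalue `z ≠ 0` formally
satisfies `ψ = -(Δ² - z)⁻¹ V ψ`. In dimension three the resolvent at `k⁴` has the kernel `(e^{ikr} -
e^{-kr}) / (8πk²r)`, `r = |x - y|`. For `k` in the open first quadrant the numerator has modulus at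
most `√2` (`norm_exp_sub_exp_le_sqrt_two`), so the kernel is bounded by `√2 / (8π|k|²r)`. Hence
`|ψ|` is dominated by the potential of `|V||ψ|` with this kernel, and Cauchy–Schwarz gives `I ≤ 2 /
(64π²|z|) · ‖V‖_R² · I` for `I = ∫ |V||ψ|²`. Here `I` is finite because `ψ` lies in the form domain,
and nonzero because otherwise the domination forces `ψ = 0`. Cancelling `I` gives the bound.

The resolvent does not exist at embedded eigenvalues. Therefore the eigenvalue equation is tested
against `(Δ² - w)⁻¹χ` with `χ` Schwartz and `w` nonreal (`MemRollnik.inner_schwartz_eigenfunction`),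
and `w` tends to `conj z`. The error term `(z - conj w)((Δ² - w)⁻¹χ, ψ)` vanishes in the limit
because the multiplier is singular only on a null set, while the kernel bound is uniform in `w`
(`MemRollnik.enorm_inner_eigenfunction_le`). Approximate identities turn the tested inequality into
a pointwise one. -/

/-! ### Differences of Yukawa potentials: size and integrability. -/

theorem norm_exp_sub_exp_le {u v : ℂ} {M : ℝ} (hu : u.re ≤ M) (hv : v.re ≤ M) :
    ‖Complex.exp u - Complex.exp v‖ ≤ Real.exp M * ‖u - v‖ := by
  have hs : Convex ℝ {w : ℂ | w.re ≤ M} := convex_halfSpace_re_le M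
  refine hs.norm_image_sub_le_of_norm_deriv_le (𝕜 := ℂ) (f := Complex.exp)
    (fun x _ ↦ Complex.differentiableAt_exp) (fun x hx ↦ ?_) hv hu
  rw [Complex.deriv_exp, Complex.norm_exp]
  exact Real.exp_le_exp.mpr hx

/-- The radial profile `(e^{-αt} - e^{-βt}) / t` of a difference of two Yukawa potentials. -/
def yukawaDiff (α β : ℂ) (t : ℝ) : ℂ :=
  (Complex.exp (-α * t) - Complex.exp (-β * t)) / t

/-- The singularities at the origin cancel: the numerator is Lipschitz in the exponents, with a
factor `t` that removes the denominator. The case `c = 0` also serves, for the bounded part of the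
kernel estimate. -/
theorem norm_yukawaDiff_le {α β : ℂ} {c t : ℝ} (hα : c ≤ α.re) (hβ : c ≤ β.re) (ht : 0 ≤ t) :
    ‖yukawaDiff α β t‖ ≤ ‖α - β‖ * Real.exp (-c * t) := by
  rcases ht.eq_or_lt with rfl | ht
  · simp [yukawaDiff]
  have h1 : (-α * t).re ≤ -c * t := by
    simp only [Complex.mul_re, Complex.neg_re, Complex.ofReal_re, Complex.ofReal_im, mul_zero,
      sub_zero]
    gcongr
  have h2 : (-β * t).re ≤ -c * t := by
    simp only [Complex.mul_re, Complex.neg_re, Complex.ofReal_re, Complex.ofReal_im, mul_zero,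
      sub_zero]
    gcongr
  rw [yukawaDiff, norm_div, div_le_iff₀ (by simpa using ht.ne')]
  refine (norm_exp_sub_exp_le h1 h2).trans_eq ?_
  have : -α * t - -β * t = -((α - β) * t) := by ring
  rw [this, norm_neg, norm_mul]
  ring

theorem measurable_yukawaDiff (α β : ℂ) : Measurable (yukawaDiff α β) := by
  unfold yukawaDiff
  fun_prop

theorem exp_neg_mul_le {c t : ℝ} (hc : 0 < c) (ht : 0 ≤ t) :
    Real.exp (-c * t) ≤ (24 * Real.exp c / c ^ 4) * (1 + t) ^ (-4 : ℝ) := by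
  -- The power 4 exceeds the dimension three, so `(1 + ‖x‖)⁻⁴` is integrable; 24 is `4!`.
  have h := Real.pow_div_factorial_le_exp (c * (1 + t)) (by positivity) 4
  have h3 : (Nat.factorial 4 : ℝ) = 24 := by norm_num [Nat.factorial]
  rw [h3, div_le_iff₀ (by norm_num)] at h
  rw [Real.rpow_neg (by positivity), show (4 : ℝ) = ((4 : ℕ) : ℝ) by norm_num, Real.rpow_natCast,
    div_mul_eq_mul_div, le_div_iff₀ (by positivity), ← div_eq_mul_inv, le_div_iff₀ (by positivity)]
  have h4 : Real.exp (-c * t) * Real.exp (c * (1 + t)) = Real.exp c := by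
    rw [← Real.exp_add]; ring_nf
  calc Real.exp (-c * t) * c ^ 4 * (1 + t) ^ 4 = Real.exp (-c * t) * (c * (1 + t)) ^ 4 := by ring
    _ ≤ Real.exp (-c * t) * (Real.exp (c * (1 + t)) * 24) := by gcongr
    _ = 24 * Real.exp c := by rw [← h4]; ring

theorem integrable_exp_neg_mul_norm {E : Type*} [NormedAddCommGroup E] [NormedSpace ℝ E]
    [FiniteDimensional ℝ E] [MeasurableSpace E] [BorelSpace E] (μ : Measure E)
    [μ.IsAddHaarMeasure] (hE : Module.finrank ℝ E < 4) {c : ℝ} (hc : 0 < c) :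
    Integrable (fun x : E ↦ Real.exp (-c * ‖x‖)) μ := by
  have h : Integrable (fun x : E ↦ (1 + ‖x‖) ^ (-4 : ℝ)) μ :=
    integrable_one_add_norm (by exact_mod_cast hE)
  refine (h.const_mul (24 * Real.exp c / c ^ 4)).mono' (by fun_prop) (ae_of_all _ fun x ↦ ?_)
  rw [Real.norm_eq_abs, abs_of_pos (Real.exp_pos _)]
  exact exp_neg_mul_le hc (norm_nonneg x)

theorem integrable_yukawaDiff_norm {E : Type*} [NormedAddCommGroup E] [NormedSpace ℝ E]
    [FiniteDimensional ℝ E] [MeasurableSpace E] [BorelSpace E] (μ : Measure E)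
    [μ.IsAddHaarMeasure] (hE : Module.finrank ℝ E < 4) {α β : ℂ} (hα : 0 < α.re) (hβ : 0 < β.re) :
    Integrable (fun x : E ↦ yukawaDiff α β ‖x‖) μ := by
  refine ((integrable_exp_neg_mul_norm μ hE (lt_min hα hβ)).const_mul ‖α - β‖).mono'
    ((measurable_yukawaDiff α β).comp measurable_norm).aestronglyMeasurable
    (ae_of_all _ fun x ↦ ?_)
  exact norm_yukawaDiff_le (min_le_left _ _) (min_le_right _ _) (norm_nonneg x)

/-! ### Fourier transform of a Yukawa difference. -/

theorem hasDerivAt_exp_sqrt {α : ℂ} (hα : α ≠ 0) {s : ℝ} (hs : s ≠ 0) (r : ℝ) :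
    HasDerivAt (fun r : ℝ ↦ -Complex.exp (-α * (√(s ^ 2 + r ^ 2) : ℝ)) / α)
      (r * Complex.exp (-α * (√(s ^ 2 + r ^ 2) : ℝ)) / (√(s ^ 2 + r ^ 2) : ℝ)) r := by
  have hp : 0 < s ^ 2 + r ^ 2 := by positivity
  have h1 : HasDerivAt (fun r : ℝ ↦ √(s ^ 2 + r ^ 2)) (r / √(s ^ 2 + r ^ 2)) r := by
    convert ((hasDerivAt_pow 2 r).const_add (s ^ 2)).sqrt hp.ne' using 1
    simp [mul_div_mul_left]
  have h2 := (((h1.ofReal_comp.const_mul (-α)).cexp).neg).div_const α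
  refine h2.congr_deriv ?_
  have : (√(s ^ 2 + r ^ 2) : ℂ) ≠ 0 := by exact_mod_cast (Real.sqrt_pos.mpr hp).ne'
  push_cast
  field_simp

theorem integrableOn_mul_exp_sqrt {α : ℂ} (hα : 0 < α.re) (s : ℝ) :
    IntegrableOn (fun r : ℝ ↦
      r * Complex.exp (-α * (√(s ^ 2 + r ^ 2) : ℝ)) / (√(s ^ 2 + r ^ 2) : ℝ)) (Ioi 0) := by
  have hi : IntegrableOn (fun r : ℝ ↦ Real.exp (-α.re * r)) (Ioi 0) :=
    integrableOn_exp_mul_Ioi (by linarith) 0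
  refine hi.mono' (Measurable.aestronglyMeasurable (by fun_prop)) ?_
  refine (ae_restrict_iff' measurableSet_Ioi).mpr (ae_of_all _ fun r hr ↦ ?_)
  have hr : 0 < r := hr
  have hle : r ≤ √(s ^ 2 + r ^ 2) := Real.le_sqrt_of_sq_le (by nlinarith [sq_nonneg s])
  have hpos : 0 < √(s ^ 2 + r ^ 2) := hr.trans_le hle
  rw [norm_div, norm_mul, Complex.norm_exp, Complex.norm_real, Complex.norm_real,
    Real.norm_of_nonneg hr.le, Real.norm_of_nonneg hpos.le, div_le_iff₀ hpos, mul_comm]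
  have : (-α * (√(s ^ 2 + r ^ 2) : ℝ)).re ≤ -α.re * r := by
    simp only [Complex.mul_re, Complex.neg_re, Complex.ofReal_re, Complex.ofReal_im, mul_zero,
      sub_zero]
    nlinarith
  gcongr

theorem integral_Ioi_mul_exp_sqrt {α : ℂ} (hα : 0 < α.re) {s : ℝ} (hs : s ≠ 0) :
    ∫ r in Ioi (0 : ℝ), r * Complex.exp (-α * (√(s ^ 2 + r ^ 2) : ℝ)) / (√(s ^ 2 + r ^ 2) : ℝ)
      = Complex.exp (-α * |s|) / α := by
  have hα0 : α ≠ 0 := by rintro rfl; simp at hα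
  have ht : Tendsto (fun r : ℝ ↦ -Complex.exp (-α * (√(s ^ 2 + r ^ 2) : ℝ)) / α) atTop (𝓝 0) := by
    rw [show (0 : ℂ) = -0 / α by simp]
    refine Tendsto.div_const (Tendsto.neg ?_) _
    rw [Complex.tendsto_exp_nhds_zero_iff]
    have h1 : Tendsto (fun r : ℝ ↦ √(s ^ 2 + r ^ 2)) atTop atTop := by
      refine tendsto_atTop_mono (fun r ↦ ?_) tendsto_id
      exact Real.le_sqrt_of_sq_le (by simp only [id]; nlinarith [sq_nonneg s])
    have h2 := tendsto_const_nhds (x := -α.re) |>.neg_mul_atTop (by linarith) h1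
    simpa using h2
  rw [integral_Ioi_of_hasDerivAt_of_tendsto' (fun r _ ↦ hasDerivAt_exp_sqrt hα0 hs r)
    (integrableOn_mul_exp_sqrt hα s) ht]
  simp [Real.sqrt_sq_eq_abs, neg_div]

theorem integral_Ioi_smul_yukawaDiff {α β : ℂ} (hα : 0 < α.re) (hβ : 0 < β.re) {s : ℝ}
    (hs : s ≠ 0) :
    ∫ r in Ioi (0 : ℝ), r • yukawaDiff α β √(s ^ 2 + r ^ 2)
      = Complex.exp (-α * |s|) / α - Complex.exp (-β * |s|) / β := by
  rw [← integral_Ioi_mul_exp_sqrt hα hs, ← integral_Ioi_mul_exp_sqrt hβ hs, ← integral_sub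
    (integrableOn_mul_exp_sqrt hα s) (integrableOn_mul_exp_sqrt hβ s)]
  refine integral_congr_ae (ae_of_all _ fun r ↦ ?_)
  simp only [yukawaDiff, Complex.real_smul]
  ring

/-- In polar coordinates of the plane at height `s`, the Jacobian `r` makes the radial integrand an
exact derivative, since `r / √(s² + r²)` is the derivative of `√(s² + r²)`. -/
theorem integral_complex_yukawaDiff {α β : ℂ} (hα : 0 < α.re) (hβ : 0 < β.re) {s : ℝ}
    (hs : s ≠ 0) :
    ∫ p : ℂ, yukawaDiff α β √(s ^ 2 + ‖p‖ ^ 2)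
      = 2 * Real.pi * (Complex.exp (-α * |s|) / α - Complex.exp (-β * |s|) / β) := by
  rw [← Complex.integral_comp_polarCoord_symm, polarCoord_target, Measure.volume_eq_prod]
  simp only [Complex.norm_polarCoord_symm, sq_abs]
  have h := setIntegral_prod_mul (μ := (volume : Measure ℝ)) (ν := (volume : Measure ℝ))
    (fun r : ℝ ↦ r • yukawaDiff α β √(s ^ 2 + r ^ 2)) (fun _ : ℝ ↦ (1 : ℂ))
    (Ioi 0) (Ioo (-Real.pi) Real.pi)
  simp only [mul_one] at h
  rw [h, integral_Ioi_smul_yukawaDiff hα hβ hs]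
  simp [Real.pi_pos.le]
  ring

/-- The half-lines contribute `1 / (α + ib)` and `1 / (α - ib)`. -/
theorem integral_exp_mul_exp_abs {α : ℂ} (hα : 0 < α.re) (b : ℝ) :
    Integrable (fun s : ℝ ↦ Complex.exp (-(b * s) * Complex.I) * Complex.exp (-α * |s|)) ∧
    ∫ s : ℝ, Complex.exp (-(b * s) * Complex.I) * Complex.exp (-α * |s|)
      = 2 * α / (α ^ 2 + b ^ 2) := by
  have h1 : (-α - b * Complex.I).re < 0 := by simp [hα]
  have h2 : 0 < (α - b * Complex.I).re := by simp [hα]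
  have e1 : EqOn (fun s : ℝ ↦ Complex.exp ((-α - b * Complex.I) * s))
      (fun s : ℝ ↦ Complex.exp (-(b * s) * Complex.I) * Complex.exp (-α * |s|)) (Ioi 0) := by
    intro s hs
    simp only [abs_of_pos (mem_Ioi.mp hs), ← Complex.exp_add]
    ring_nf
  have e2 : EqOn (fun s : ℝ ↦ Complex.exp ((α - b * Complex.I) * s))
      (fun s : ℝ ↦ Complex.exp (-(b * s) * Complex.I) * Complex.exp (-α * |s|)) (Iic 0) := by
    intro s hs
    simp only [abs_of_nonpos (mem_Iic.mp hs), ← Complex.exp_add]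
    push_cast
    ring_nf
  have i1 := (integrableOn_exp_mul_complex_Ioi h1 0).congr_fun e1 measurableSet_Ioi
  have i2 := (integrableOn_exp_mul_complex_Iic h2 0).congr_fun e2 measurableSet_Iic
  have i3 := integrableOn_univ.mp (Iic_union_Ioi (a := (0 : ℝ)) ▸ i2.union i1)
  refine ⟨i3, ?_⟩
  rw [← intervalIntegral.integral_Iic_add_Ioi i2 i1, ← setIntegral_congr_fun measurableSet_Ioi e1,
    ← setIntegral_congr_fun measurableSet_Iic e2, integral_exp_mul_complex_Ioi h1,
    integral_exp_mul_complex_Iic h2]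
  have n1 : -α - b * Complex.I ≠ 0 := by intro h; simp [h] at h1
  have n2 : α - b * Complex.I ≠ 0 := by intro h; simp [h] at h2
  have n3 : α ^ 2 + b ^ 2 ≠ 0 := by
    have : α ^ 2 + (b : ℂ) ^ 2 = -((-α - b * Complex.I) * (α - b * Complex.I)) := by
      ring_nf; simp
    rw [this]
    exact neg_ne_zero.mpr (mul_ne_zero n1 n2)
  simp only [Complex.ofReal_zero, mul_zero, Complex.exp_zero]
  field_simp
  ring_nf
  simp

/-- For a frequency on the axis the phase depends only on the axial coordinate, so integrating out
the orthogonal plane (modelled by `ℂ`) leaves a one-dimensional Fourier integral of `e^{-α|s|} / α`.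
-/
theorem fourier_yukawaDiff_prod {α β : ℂ} (hα : 0 < α.re) (hβ : 0 < β.re) (b : ℝ) :
    𝓕 (fun x : WithLp 2 (ℝ × ℂ) ↦ yukawaDiff α β ‖x‖) (WithLp.toLp 2 (b, 0))
      = 4 * Real.pi / (α ^ 2 + (2 * Real.pi * b) ^ 2)
        - 4 * Real.pi / (β ^ 2 + (2 * Real.pi * b) ^ 2) := by
  have hdim : Module.finrank ℝ (WithLp 2 (ℝ × ℂ)) < 4 := by
    rw [(WithLp.linearEquiv 2 ℝ (ℝ × ℂ)).finrank_eq, Module.finrank_prod,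
      Complex.finrank_real_complex]
    simp
  have hint := integrable_yukawaDiff_norm (volume : Measure (WithLp 2 (ℝ × ℂ))) hdim hα hβ
  have hnorm (p : ℝ × ℂ) : ‖WithLp.toLp 2 p‖ = √(p.1 ^ 2 + ‖p.2‖ ^ 2) := by
    rw [WithLp.prod_norm_eq_of_L2]; simp
  set e := (MeasurableEquiv.toLp 2 (ℝ × ℂ))
  have hmp : MeasurePreserving e volume volume := WithLp.volume_preserving_toLp ℝ ℂ
  have hint' : Integrable (fun p : ℝ × ℂ ↦
      Complex.exp (-((2 * Real.pi * b : ℝ) * p.1) * Complex.I)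
        * yukawaDiff α β √(p.1 ^ 2 + ‖p.2‖ ^ 2)) (volume.prod volume) := by
    have h1 : Integrable (fun p : ℝ × ℂ ↦ yukawaDiff α β √(p.1 ^ 2 + ‖p.2‖ ^ 2))
        (volume.prod volume) := by
      have := (hmp.integrable_comp_emb e.measurableEmbedding).mpr hint
      refine this.congr (ae_of_all _ fun p ↦ ?_)
      simp only [Function.comp_apply]
      rw [← hnorm]
      rfl
    refine h1.bdd_mul (c := 1) (Measurable.aestronglyMeasurable (by fun_prop))
      (ae_of_all _ fun p ↦ ?_)
    rw [Complex.norm_exp]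
    simp
  have key : ∀ᵐ s : ℝ, ∫ p : ℂ, Complex.exp (-((2 * Real.pi * b : ℝ) * s) * Complex.I)
        * yukawaDiff α β √(s ^ 2 + ‖p‖ ^ 2)
      = 2 * Real.pi / α * (Complex.exp (-((2 * Real.pi * b : ℝ) * s) * Complex.I)
          * Complex.exp (-α * |s|))
        - 2 * Real.pi / β * (Complex.exp (-((2 * Real.pi * b : ℝ) * s) * Complex.I)
          * Complex.exp (-β * |s|)) := by
    filter_upwards [Measure.ae_ne volume (0 : ℝ)] with s hs
    rw [integral_const_mul, integral_complex_yukawaDiff hα hβ hs]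
    ring
  obtain ⟨iα, eα⟩ := integral_exp_mul_exp_abs hα (2 * Real.pi * b)
  obtain ⟨iβ, eβ⟩ := integral_exp_mul_exp_abs hβ (2 * Real.pi * b)
  have hα0 : α ≠ 0 := by rintro rfl; simp at hα
  have hβ0 : β ≠ 0 := by rintro rfl; simp at hβ
  rw [Real.fourier_eq', ← hmp.integral_comp e.measurableEmbedding]
  calc _ = ∫ p : ℝ × ℂ, Complex.exp (-((2 * Real.pi * b : ℝ) * p.1) * Complex.I)
        * yukawaDiff α β √(p.1 ^ 2 + ‖p.2‖ ^ 2) ∂(volume.prod volume) := by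
        refine integral_congr_ae (ae_of_all _ fun p ↦ ?_)
        have hin : inner ℝ (e p) (WithLp.toLp 2 (b, (0 : ℂ))) = b * p.1 := by
          simp [WithLp.prod_inner_apply, e]
        simp only [hin, smul_eq_mul]
        rw [show e p = WithLp.toLp 2 p from rfl, hnorm]
        congr 2
        push_cast
        ring
    _ = _ := by
        rw [integral_prod _ hint', integral_congr_ae key,
          integral_sub (iα.const_mul _) (iβ.const_mul _), integral_const_mul, integral_const_mul,
          eα, eβ]
        push_cast
        field_simp
        ring

theorem fourier_yukawaDiff {α β : ℂ} (hα : 0 < α.re) (hβ : 0 < β.re) (ξ : R3) :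
    𝓕 (fun x : R3 ↦ yukawaDiff α β ‖x‖) ξ
      = 4 * Real.pi / (α ^ 2 + (2 * Real.pi * ‖ξ‖) ^ 2)
        - 4 * Real.pi / (β ^ 2 + (2 * Real.pi * ‖ξ‖) ^ 2) := by
  have hdim : Module.finrank ℝ R3 = Module.finrank ℝ (WithLp 2 (ℝ × ℂ)) := by
    rw [(WithLp.linearEquiv 2 ℝ (ℝ × ℂ)).finrank_eq, Module.finrank_prod,
      Complex.finrank_real_complex]
    simp
  let A : R3 ≃ₗᵢ[ℝ] WithLp 2 (ℝ × ℂ) := (stdOrthonormalBasis ℝ R3).equiv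
    (stdOrthonormalBasis ℝ (WithLp 2 (ℝ × ℂ))) (finCongr hdim)
  let e : WithLp 2 (ℝ × ℂ) := WithLp.toLp 2 (‖ξ‖, 0)
  have he : ‖A ξ‖ = ‖e‖ := by
    rw [A.norm_map, WithLp.prod_norm_eq_of_L2]
    simp [e]
  -- A reflection carries `A ξ` to the axis vector of equal length; radial functions are unaffected
  -- by `B`.
  let B := A.trans (Submodule.reflection (Submodule.span ℝ {A ξ - e})ᗮ)
  have hB : B ξ = e := Submodule.reflection_sub he
  have h := Real.fourier_comp_linearIsometry B (fun x ↦ yukawaDiff α β ‖x‖) ξ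
  rw [hB, fourier_yukawaDiff_prod hα hβ] at h
  rw [← h]
  have hc : (fun x : R3 ↦ yukawaDiff α β ‖x‖)
      = (fun x : WithLp 2 (ℝ × ℂ) ↦ yukawaDiff α β ‖x‖) ∘ B := by
    funext x
    simp only [Function.comp_apply, B.norm_map]
  rw [hc]

/-! ### The biharmonic resolvent kernel and its majorant. -/

/-- A square root `s` can be taken in the upper half-plane; a square root of `s` then has real and
imaginary parts of equal sign, both positive after a change of sign. -/
theorem exists_fourth_root {w : ℂ} (hw : w.im ≠ 0) : ∃ k : ℂ, 0 < k.re ∧ 0 < k.im ∧ k ^ 4 = w := by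
  obtain ⟨s, hs, hsw⟩ : ∃ s : ℂ, 0 < s.im ∧ s ^ 2 = w := by
    obtain ⟨s, hs⟩ := IsAlgClosed.exists_pow_nat_eq w (n := 2) (by norm_num)
    have hne : s.im ≠ 0 := by
      intro h
      apply hw
      rw [← hs]
      simp [sq, h]
    rcases hne.lt_or_gt with h | h
    · exact ⟨-s, by simpa using h, by rw [← hs]; ring⟩
    · exact ⟨s, h, hs⟩
  obtain ⟨k, hk⟩ := IsAlgClosed.exists_pow_nat_eq s (n := 2) (by norm_num)
  have him : s.im = 2 * (k.re * k.im) := by rw [← hk]; simp [sq]; ring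
  have hpos : 0 < k.re * k.im := by linarith
  have h4 : k ^ 4 = w := by rw [← hsw, ← hk]; ring
  rcases mul_pos_iff.mp hpos with ⟨h1, h2⟩ | ⟨h1, h2⟩
  · exact ⟨k, h1, h2, h4⟩
  · exact ⟨-k, by simpa using h1, by simpa using h2, by rw [← h4]; ring⟩

/-- The resolvent kernel of the biharmonic operator `Δ²` in dimension three at the spectral
parameter `k⁴`. -/
def greenKernel (k : ℂ) (x : R3) : ℂ :=
  (8 * Real.pi * k ^ 2)⁻¹ * yukawaDiff (-Complex.I * k) k ‖x‖

/-- A majorant for all kernels `greenKernel k` with `κ ≤ ‖k‖`, as a function of the radius. -/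
def greenMajorant (κ r : ℝ) : ℝ :=
  √2 / (8 * Real.pi) * min (1 / κ) (1 / (κ ^ 2 * r))

/-- This is the source of the sharp factor `1/2` in the theorem; the triangle inequality would only
give the bound 2. The phase difference `θ` of the exponentials is also their joint decay, `PQ =
e^{-θ}`, so they cannot point in opposite directions before one has decayed. -/
theorem norm_exp_sub_exp_le_sqrt_two {k : ℂ} (h1 : 0 < k.re) (h2 : 0 < k.im) {t : ℝ} (ht : 0 ≤ t) :
    ‖Complex.exp (-(-Complex.I * k) * t) - Complex.exp (-k * t)‖ ≤ √2 := by
  apply Real.le_sqrt_of_sq_le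
  set P := Real.exp (-(k.im * t)) with hP
  set Q := Real.exp (-(k.re * t)) with hQ
  set θ := k.re * t + k.im * t with hθ
  have hP0 : 0 < P := Real.exp_pos _
  have hQ0 : 0 < Q := Real.exp_pos _
  have hP1 : P ≤ 1 := Real.exp_le_one_iff.mpr (by have := mul_nonneg h2.le ht; linarith)
  have hQ1 : Q ≤ 1 := Real.exp_le_one_iff.mpr (by have := mul_nonneg h1.le ht; linarith)
  have hPQ : P * Q = Real.exp (-θ) := by rw [hP, hQ, ← Real.exp_add, hθ]; ring_nf
  have key : ‖Complex.exp (-(-Complex.I * k) * t) - Complex.exp (-k * t)‖ ^ 2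
      = P ^ 2 + Q ^ 2 - 2 * (P * Q) * Real.cos θ := by
    rw [← Complex.normSq_eq_norm_sq, Complex.normSq_apply]
    simp only [Complex.sub_re, Complex.sub_im, Complex.exp_re, Complex.exp_im]
    have e1 : (-(-Complex.I * k) * t).re = -(k.im * t) := by simp
    have e2 : (-(-Complex.I * k) * t).im = k.re * t := by simp
    have e3 : (-k * t).re = -(k.re * t) := by simp
    have e4 : (-k * t).im = -(k.im * t) := by simp
    rw [e1, e2, e3, e4, ← hP, ← hQ, hθ, Real.cos_add, Real.cos_neg, Real.sin_neg]
    have s1 := Real.sin_sq_add_cos_sq (k.re * t)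
    have s2 := Real.sin_sq_add_cos_sq (k.im * t)
    linear_combination P ^ 2 * s1 + Q ^ 2 * s2
  rw [key]
  by_cases hc : 0 ≤ Real.cos θ
  · have := mul_nonneg (mul_nonneg hP0.le hQ0.le) hc
    nlinarith
  -- A negative cosine forces `θ > π/2 > 3/2`, hence `PQ ≤ 1 / (1 + θ) ≤ 2/5`. With `P² + Q² ≤ 1 +
  -- P²Q²` the square is at most `(1 + PQ)² ≤ (7/5)² < 2`.
  · have hθ2 : 3 / 2 ≤ θ := by
      by_contra h
      apply hc
      refine Real.cos_nonneg_of_mem_Icc ⟨?_, ?_⟩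
      · have := mul_nonneg h1.le ht
        have := mul_nonneg h2.le ht
        linarith [Real.pi_pos]
      · linarith [Real.pi_gt_three]
    have hPQ' : P * Q ≤ 2 / 5 := by
      rw [hPQ, Real.exp_neg, inv_le_comm₀ (Real.exp_pos _) (by norm_num)]
      linarith [Real.add_one_le_exp θ]
    have hcos := Real.neg_one_le_cos θ
    have hPQ0 : 0 < P * Q := mul_pos hP0 hQ0
    have : (1 - P ^ 2) * (1 - Q ^ 2) ≥ 0 := mul_nonneg (by nlinarith) (by nlinarith)
    nlinarith

theorem norm_greenKernel_le {k : ℂ} (h1 : 0 < k.re) (h2 : 0 < k.im) {κ : ℝ} (hκ : 0 < κ)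
    (hk : κ ≤ ‖k‖) (x : R3) : ‖greenKernel k x‖ ≤ greenMajorant κ ‖x‖ := by
  have hk0 : 0 < ‖k‖ := hκ.trans_le hk
  have hpi := Real.pi_pos
  have hn : ‖(8 * Real.pi * k ^ 2)⁻¹‖ = (8 * Real.pi * ‖k‖ ^ 2)⁻¹ := by
    simp [abs_of_pos hpi]
  rw [greenKernel, norm_mul, hn, greenMajorant, mul_min_of_nonneg _ _ (by positivity)]
  apply le_min
  · have hb := norm_yukawaDiff_le (α := -Complex.I * k) (β := k) (c := 0) (by simpa using h2.le)
      h1.le (norm_nonneg x)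
    have hd : ‖-Complex.I * k - k‖ = √2 * ‖k‖ := by
      rw [show -Complex.I * k - k = -((1 + Complex.I) * k) by ring, norm_neg, norm_mul]
      congr 1
      rw [Complex.norm_def, Complex.normSq_apply]
      norm_num
    rw [hd, neg_zero, zero_mul, Real.exp_zero, mul_one] at hb
    calc _ ≤ (8 * Real.pi * ‖k‖ ^ 2)⁻¹ * (√2 * ‖k‖) := by gcongr
      _ = √2 / (8 * Real.pi) * (1 / ‖k‖) := by field_simp
      _ ≤ _ := by gcongr
  · rcases (norm_nonneg x).eq_or_lt with hx | hx
    · rw [← hx]; simp [yukawaDiff]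
    have hb : ‖yukawaDiff (-Complex.I * k) k ‖x‖‖ ≤ √2 / ‖x‖ := by
      rw [yukawaDiff, norm_div, Complex.norm_real, norm_norm]
      gcongr
      exact norm_exp_sub_exp_le_sqrt_two h1 h2 hx.le
    calc _ ≤ (8 * Real.pi * ‖k‖ ^ 2)⁻¹ * (√2 / ‖x‖) := by gcongr
      _ = √2 / (8 * Real.pi) * (1 / (‖k‖ ^ 2 * ‖x‖)) := by field_simp
      _ ≤ _ := by gcongr

theorem greenMajorant_nonneg {κ r : ℝ} (hκ : 0 < κ) (hr : 0 ≤ r) : 0 ≤ greenMajorant κ r := by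
  unfold greenMajorant
  positivity

/-- The bounded branch of the minimum controls small `r`, the `1/r` branch large `r`. The resulting
`(1 + r)⁻¹` decay makes the potential of `|V||ψ|` finite at every point. -/
theorem greenMajorant_mul_le {κ r : ℝ} (hκ : 0 < κ) (hr : 0 ≤ r) :
    greenMajorant κ r * (1 + r) ≤ √2 / (8 * Real.pi) * (1 / κ + 1 / κ ^ 2) := by
  have h1 : min (1 / κ) (1 / (κ ^ 2 * r)) ≤ 1 / κ := min_le_left _ _
  have h2 : min (1 / κ) (1 / (κ ^ 2 * r)) * r ≤ 1 / κ ^ 2 := by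
    rcases hr.eq_or_lt with rfl | hr
    · simp; positivity
    calc _ ≤ 1 / (κ ^ 2 * r) * r := by gcongr; exact min_le_right _ _
      _ = _ := by field_simp
  rw [greenMajorant, mul_assoc]
  gcongr
  linarith

theorem integrable_greenKernel {k : ℂ} (h1 : 0 < k.re) (h2 : 0 < k.im) :
    Integrable (greenKernel k) := by
  refine (integrable_yukawaDiff_norm (volume : Measure R3) (by simp) (α := -Complex.I * k) (β := k)
    (by simpa using h2) h1).const_mul _

theorem ofReal_sub_ne_zero {w : ℂ} (hw : w.im ≠ 0) (t : ℝ) : (t : ℂ) - w ≠ 0 := by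
  intro h
  apply hw
  have := congrArg Complex.im h
  simpa using this

/-- With `A = (2π|ξ|)²` this is the partial fraction `1/(A - k²) - 1/(A + k²) = 2k² / (A² - k⁴)`,
which explains the exponents `-ik`, `k` and the prefactor `1/(8πk²)`. -/
theorem fourier_greenKernel {k : ℂ} (h1 : 0 < k.re) (h2 : 0 < k.im) (ξ : R3) :
    𝓕 (greenKernel k) ξ = (((2 * Real.pi * ‖ξ‖) ^ 4 : ℝ) - k ^ 4)⁻¹ := by
  have hk0 : k ≠ 0 := by rintro rfl; simp at h1
  have hy := fourier_yukawaDiff (α := -Complex.I * k) (β := k) (by simpa using h2) h1 ξ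
  have hsq : (k ^ 2).im ≠ 0 := by
    have : (k ^ 2).im = 2 * (k.re * k.im) := by simp [sq]; ring
    rw [this]; positivity
  have n1 := ofReal_sub_ne_zero hsq ((2 * Real.pi * ‖ξ‖) ^ 2)
  have n2 := ofReal_sub_ne_zero (w := -k ^ 2) (by simpa using hsq) ((2 * Real.pi * ‖ξ‖) ^ 2)
  have hG : 𝓕 (greenKernel k) ξ
      = (8 * Real.pi * k ^ 2)⁻¹ * 𝓕 (fun x : R3 ↦ yukawaDiff (-Complex.I * k) k ‖x‖) ξ := by
    rw [Real.fourier_eq', Real.fourier_eq', ← integral_const_mul]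
    refine integral_congr_ae (ae_of_all _ fun x ↦ ?_)
    simp only [greenKernel, smul_eq_mul]
    ring
  have hI : (-Complex.I * k) ^ 2 = -k ^ 2 := by rw [mul_pow, neg_sq, Complex.I_sq]; ring
  rw [hG, hy, hI]
  have hpi : (Real.pi : ℂ) ≠ 0 := by exact_mod_cast Real.pi_ne_zero
  push_cast at n1 n2 ⊢
  set A : ℂ := (2 * Real.pi * ‖ξ‖) ^ 2
  have e : (2 * Real.pi * ‖ξ‖ : ℂ) ^ 4 - k ^ 4 = (A - k ^ 2) * (A - -k ^ 2) := by
    simp only [A]; ring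
  have n3 : -k ^ 2 + A ≠ 0 := by rwa [neg_add_eq_sub]
  have n4 : k ^ 2 + A ≠ 0 := by rwa [sub_neg_eq_add, add_comm] at n2
  rw [e, sub_neg_eq_add, ← neg_add_eq_sub (k ^ 2) A, add_comm A]
  rw [neg_add_eq_sub] at *
  field_simp
  ring

/-! ### The resolvent on Schwartz functions. -/

theorem iteratedDeriv_inv_sub {w : ℂ} (hw : w.im ≠ 0) (n : ℕ) :
    iteratedDeriv n (fun t : ℝ ↦ ((t : ℂ) - w)⁻¹)
      = fun t : ℝ ↦ (-1) ^ n * n.factorial * (((t : ℂ) - w)⁻¹) ^ (n + 1) := by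
  induction n with
  | zero => ext t; simp
  | succ n ih =>
    rw [iteratedDeriv_succ, ih]
    ext t
    have h0 := ofReal_sub_ne_zero hw t
    have h1 : HasDerivAt (fun t : ℝ ↦ (t : ℂ) - w) 1 t :=
      (Complex.ofRealCLM.hasDerivAt (x := t)).sub_const w
    have h2 := ((h1.fun_inv h0).fun_pow (n + 1)).const_mul ((-1) ^ n * (n.factorial : ℂ))
    rw [h2.deriv, Nat.factorial_succ]
    push_cast
    simp only [inv_pow]
    field_simp
    ring

/-- All derivatives are bounded, because `|t - w| ≥ |Im w|` on the real line. Hence for nonreal `w`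
the multiplier maps Schwartz functions to Schwartz functions. -/
theorem hasTemperateGrowth_inv_sub {w : ℂ} (hw : w.im ≠ 0) :
    Function.HasTemperateGrowth (fun t : ℝ ↦ ((t : ℂ) - w)⁻¹) := by
  refine ⟨?_, fun n ↦ ⟨0, n.factorial * (|w.im|⁻¹) ^ (n + 1), fun t ↦ ?_⟩⟩
  · have : ContDiff ℝ ((⊤ : ℕ∞) : WithTop ℕ∞) (fun t : ℝ ↦ (t : ℂ) - w) := Complex.ofRealCLM.contDiff.sub contDiff_const
    exact this.inv (ofReal_sub_ne_zero hw)
  · rw [norm_iteratedFDeriv_eq_norm_iteratedDeriv, iteratedDeriv_inv_sub hw]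
    have h : |w.im| ≤ ‖(t : ℂ) - w‖ := by
      simpa using Complex.abs_im_le_norm ((t : ℂ) - w)
    simp only [norm_mul, norm_pow, norm_neg, norm_one, one_pow, one_mul, norm_inv, pow_zero,
      mul_one, Complex.norm_natCast]
    gcongr

/-- The Fourier multiplier of the resolvent `(Δ² - w)⁻¹`. -/
def resolventSymbol (w : ℂ) (ξ : R3) : ℂ := (((2 * Real.pi * ‖ξ‖) ^ 4 : ℝ) - w)⁻¹

theorem hasTemperateGrowth_resolventSymbol {w : ℂ} (hw : w.im ≠ 0) :
    (resolventSymbol w).HasTemperateGrowth := by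
  have h : Function.HasTemperateGrowth (fun ξ : R3 ↦ (2 * Real.pi * ‖ξ‖) ^ 4) := by
    have : (fun ξ : R3 ↦ (2 * Real.pi * ‖ξ‖) ^ 4)
        = fun ξ ↦ (2 * Real.pi) ^ 4 * ((fun ξ : R3 ↦ ‖ξ‖ ^ 2) ^ 2) ξ := by
      ext ξ; simp; ring
    rw [this]
    exact (Function.HasTemperateGrowth.const _).mul
      ((Function.hasTemperateGrowth_norm_sq R3).pow 2)
  exact (hasTemperateGrowth_inv_sub hw).comp h

/-- The resolvent `(Δ² - w)⁻¹` on Schwartz functions. -/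
def schwartzResolvent (w : ℂ) (χ : 𝓢(R3, ℂ)) : 𝓢(R3, ℂ) :=
  SchwartzMap.fourierMultiplierCLM ℂ (resolventSymbol w) χ

theorem fourier_schwartzResolvent {w : ℂ} (hw : w.im ≠ 0) (χ : 𝓢(R3, ℂ)) (ξ : R3) :
    (𝓕 (schwartzResolvent w χ)) ξ = resolventSymbol w ξ * (𝓕 χ) ξ := by
  rw [schwartzResolvent, SchwartzMap.fourierMultiplierCLM_apply,
    FourierTransform.fourier_fourierInv_eq,
    SchwartzMap.smulLeftCLM_apply_apply (hasTemperateGrowth_resolventSymbol hw), smul_eq_mul]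

theorem fourier_laplacian_apply (f : 𝓢(R3, ℂ)) (ξ : R3) :
    (𝓕 (Δ f)) ξ = ((-(2 * Real.pi * ‖ξ‖) ^ 2 : ℝ) : ℂ) * (𝓕 f) ξ := by
  rw [SchwartzMap.laplacian_eq_fourierMultiplierCLM, SchwartzMap.fourierMultiplierCLM_apply]
  rw [FourierTransform.fourier_smul, FourierTransform.fourier_fourierInv_eq, smul_apply,
    SchwartzMap.smulLeftCLM_apply_apply (by fun_prop)]
  simp only [Complex.real_smul]
  push_cast
  ring

theorem laplacian_laplacian_schwartzResolvent {w : ℂ} (hw : w.im ≠ 0) (χ : 𝓢(R3, ℂ)) :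
    Δ (Δ (schwartzResolvent w χ)) - w • schwartzResolvent w χ = χ := by
  have h : 𝓕 (Δ (Δ (schwartzResolvent w χ)) - w • schwartzResolvent w χ) = 𝓕 χ := by
    ext ξ
    rw [sub_eq_add_neg, ← neg_smul, FourierTransform.fourier_add, FourierTransform.fourier_smul]
    simp only [add_apply, smul_apply, fourier_laplacian_apply,
      fourier_schwartzResolvent hw, resolventSymbol, smul_eq_mul]
    have := ofReal_sub_ne_zero hw ((2 * Real.pi * ‖ξ‖) ^ 4)
    push_cast at this ⊢
    linear_combination (𝓕 χ) ξ * inv_mul_cancel₀ this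
  simpa only [FourierTransform.fourierInv_fourier_eq] using congrArg (𝓕⁻ · : 𝓢(R3, ℂ) → 𝓢(R3, ℂ)) h

theorem schwartzResolvent_eq_integral {k : ℂ} (h1 : 0 < k.re) (h2 : 0 < k.im)
    (hk : (k ^ 4).im ≠ 0) (χ : 𝓢(R3, ℂ)) (x : R3) :
    schwartzResolvent (k ^ 4) χ x = ∫ y, greenKernel k (x - y) * χ y := by
  -- `E` is chosen so that its Fourier transform at `y` is `χ (x - y)`; the identity `∫ Ĝ E = ∫ G Ê`
  -- then turns the multiplier into a convolution.
  let E : R3 → ℂ := fun ξ ↦ (Real.fourierChar (inner ℝ ξ x) : ℂ) * (𝓕 χ) ξ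
  have hE : Integrable E := by
    refine (𝓕 χ).integrable.bdd_mul (c := 1) (Continuous.aestronglyMeasurable ?_)
      (ae_of_all _ fun ξ ↦ (Circle.norm_coe _).le)
    exact continuous_subtype_val.comp (Real.continuous_fourierChar.comp (by fun_prop))
  have hflip := VectorFourier.integral_fourierIntegral_smul_eq_flip (μ := (volume : Measure R3))
    (ν := (volume : Measure R3)) (L := innerₗ R3) (F := ℂ)
    Real.continuous_fourierChar continuous_inner (integrable_greenKernel h1 h2) hE
  have hG (ξ : R3) : VectorFourier.fourierIntegral Real.fourierChar volume (innerₗ R3)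
      (greenKernel k) ξ = resolventSymbol (k ^ 4) ξ := fourier_greenKernel h1 h2 ξ
  have hF (y : R3) : VectorFourier.fourierIntegral Real.fourierChar volume (innerₗ R3).flip E y
      = χ (x - y) := by
    rw [← FourierTransform.fourierInv_fourier_eq (E := 𝓢(R3, ℂ)) (F := 𝓢(R3, ℂ)) χ,
      SchwartzMap.fourierInv_coe, Real.fourierInv_eq, VectorFourier.fourierIntegral]
    refine integral_congr_ae (ae_of_all _ fun ξ ↦ ?_)
    simp only [E, Circle.smul_def, smul_eq_mul, LinearMap.flip_apply, innerₗ_apply_apply,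
      inner_sub_right]
    rw [← mul_assoc, ← Circle.coe_mul, ← AddChar.map_add_eq_mul, real_inner_comm ξ y]
    ring_nf
  simp only [hG, hF, smul_eq_mul] at hflip
  calc schwartzResolvent (k ^ 4) χ x = ∫ ξ, resolventSymbol (k ^ 4) ξ * E ξ := by
        rw [← FourierTransform.fourierInv_fourier_eq (E := 𝓢(R3, ℂ)) (F := 𝓢(R3, ℂ))
          (schwartzResolvent (k ^ 4) χ), SchwartzMap.fourierInv_coe, Real.fourierInv_eq]
        refine integral_congr_ae (ae_of_all _ fun ξ ↦ ?_)
        simp only [E, Circle.smul_def, smul_eq_mul]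
        rw [fourier_schwartzResolvent hk]
        ring
    _ = ∫ y, greenKernel k y * χ (x - y) := hflip
    _ = ∫ y, greenKernel k (x - y) * χ y := by
        rw [← integral_sub_left_eq_self _ volume x]
        simp

theorem enorm_schwartzResolvent_le {κ : ℝ} (hκ : 0 < κ) {w : ℂ} (hw : w.im ≠ 0)
    (hκw : κ ^ 4 ≤ ‖w‖) (χ : 𝓢(R3, ℂ)) (x : R3) :
    ‖schwartzResolvent w χ x‖ₑ
      ≤ ∫⁻ y, ENNReal.ofReal (greenMajorant κ ‖x - y‖) * ‖χ y‖ₑ := by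
  obtain ⟨k, h1, h2, rfl⟩ := exists_fourth_root hw
  have hk : κ ≤ ‖k‖ := by
    rw [norm_pow] at hκw
    exact le_of_pow_le_pow_left₀ (by norm_num) (norm_nonneg _) hκw
  rw [schwartzResolvent_eq_integral h1 h2 hw]
  refine (enorm_integral_le_lintegral_enorm _).trans (lintegral_mono fun y ↦ ?_)
  rw [enorm_mul]
  gcongr
  rw [← ofReal_norm]
  exact ENNReal.ofReal_le_ofReal (norm_greenKernel_le h1 h2 hκ hk _)

/-! ### Weighted integrability of Rollnik potentials. -/

/-- The weight `(1 + ‖x‖)⁻¹`. -/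
def radialWeight (x : R3) : ℝ≥0∞ := ENNReal.ofReal (1 + ‖x‖)⁻¹

theorem measurable_radialWeight : Measurable radialWeight := by
  unfold radialWeight
  fun_prop

theorem radialWeight_mul_le_inv_enorm_sub {R : ℝ} (hR : 0 ≤ R) {x y : R3} (hy : ‖y‖ ≤ R) :
    radialWeight x * ENNReal.ofReal (1 + R)⁻¹ ≤ ‖x - y‖ₑ⁻¹ := by
  rw [radialWeight, ← ENNReal.ofReal_mul (by positivity), ← mul_inv,
    ENNReal.ofReal_inv_of_pos (by positivity), ENNReal.inv_le_inv, ← ofReal_norm]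
  refine ENNReal.ofReal_le_ofReal ((norm_sub_le x y).trans ?_)
  nlinarith [norm_nonneg x]

/-- If `V` has mass on some ball, restrict `y` to it: there `|x - y| ≤ (1 + n)(1 + |x|)`, so the
Rollnik integral dominates a positive multiple of the weighted integral. Otherwise `V = 0` almost
everywhere. -/
theorem MemRollnik.lintegral_mul_radialWeight_sq_lt_top {V : R3 → ℂ} (hV : MemRollnik V) :
    ∫⁻ x, ‖V x‖ₑ * radialWeight x ^ 2 < ∞ := by
  have hVm := hV.locallyIntegrable.aestronglyMeasurable.enorm
  by_cases h0 : ∀ n : ℕ, ∫⁻ y in Metric.closedBall (0 : R3) n, ‖V y‖ₑ = 0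
  · have : ∀ᵐ x : R3, ‖V x‖ₑ = 0 := by
      have h1 : ∀ n : ℕ, ∀ᵐ x : R3, x ∈ Metric.closedBall (0 : R3) n → ‖V x‖ₑ = 0 := fun n ↦
        (ae_restrict_iff' Metric.isClosed_closedBall.measurableSet).mp
          ((lintegral_eq_zero_iff' hVm.restrict).mp (h0 n))
      filter_upwards [ae_all_iff.mpr h1] with x hx
      obtain ⟨n, hn⟩ := exists_nat_ge ‖x‖
      exact hx n (by simpa using hn)
    rw [lintegral_congr_ae (g := fun _ ↦ 0) (by filter_upwards [this] with x hx; simp [hx])]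
    simp
  · push Not at h0
    obtain ⟨n, hn⟩ := h0
    set m := ∫⁻ y in Metric.closedBall (0 : R3) n, ‖V y‖ₑ
    set c := ENNReal.ofReal (1 + (n : ℝ))⁻¹
    have hc : c ≠ 0 := by simp only [c, ne_eq, ENNReal.ofReal_eq_zero, not_le]; positivity
    have hle : (∫⁻ x, ‖V x‖ₑ * radialWeight x ^ 2) * (c ^ 2 * m) ≤ rollnikIntegral V := by
      have hm : AEMeasurable (fun x ↦ ‖V x‖ₑ * radialWeight x ^ 2) :=
        hVm.mul (measurable_radialWeight.pow_const 2).aemeasurable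
      rw [← lintegral_mul_const'' _ hm]
      refine lintegral_mono fun x ↦ ?_
      rw [← mul_assoc, ← lintegral_const_mul'' _ hVm.restrict]
      refine le_trans ?_ (setLIntegral_le_lintegral (Metric.closedBall (0 : R3) n) _)
      refine setLIntegral_mono' Metric.isClosed_closedBall.measurableSet fun y hy ↦ ?_
      have hw := radialWeight_mul_le_inv_enorm_sub (x := x) (Nat.cast_nonneg n)
        (by simpa using hy)
      rw [ENNReal.div_eq_inv_mul, ENNReal.inv_pow]
      calc ‖V x‖ₑ * radialWeight x ^ 2 * c ^ 2 * ‖V y‖ₑ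
          = (radialWeight x * c) ^ 2 * (‖V x‖ₑ * ‖V y‖ₑ) := by ring
        _ ≤ _ := by gcongr
    have hlt := hle.trans_lt hV.integral_lt_top
    exact ENNReal.lt_top_of_mul_ne_top_left hlt.ne (mul_ne_zero (pow_ne_zero _ hc) hn)

theorem exists_enorm_le_radialWeight (χ : 𝓢(R3, ℂ)) :
    ∃ C : ℝ, 0 ≤ C ∧ ∀ x, ‖χ x‖ₑ ≤ ENNReal.ofReal C * radialWeight x := by
  refine ⟨SchwartzMap.seminorm ℝ 0 0 χ + SchwartzMap.seminorm ℝ 1 0 χ, by positivity, fun x ↦ ?_⟩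
  rw [radialWeight, ← ENNReal.ofReal_mul (by positivity), ← ofReal_norm]
  refine ENNReal.ofReal_le_ofReal ?_
  rw [← div_eq_mul_inv, le_div_iff₀ (by positivity)]
  have h0 := SchwartzMap.norm_pow_mul_le_seminorm ℝ χ 0 x
  have h1 := SchwartzMap.norm_pow_mul_le_seminorm ℝ χ 1 x
  linarith

/-! ### Testing the eigenvalue equation against Schwartz functions. -/

theorem schwartz_mem_sobolevH2 (φ : 𝓢(R3, ℂ)) : φ.toLp 2 (volume : Measure R3) ∈ sobolevH2 := by
  rw [mem_sobolevH2, Lp.toTemperedDistribution_toLp_eq]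
  exact φ.memSobolev

theorem MemRollnik.schwartz_mem_formDomain {V : R3 → ℂ} (hV : MemRollnik V) (φ : 𝓢(R3, ℂ)) :
    φ.toLp 2 (volume : Measure R3) ∈ formDomain V hV.locallyIntegrable := by
  refine ⟨schwartz_mem_sobolevH2 φ, ?_⟩
  obtain ⟨C, -, hC⟩ := exists_enorm_le_radialWeight φ
  show ∫⁻ x, ‖V x‖ₑ * ‖φ.toLp 2 (volume : Measure R3) x‖ₑ ^ 2 < ∞
  refine lt_of_le_of_lt (b := ∫⁻ x, ENNReal.ofReal C ^ 2 * (‖V x‖ₑ * radialWeight x ^ 2)) ?_ ?_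
  · refine lintegral_mono_ae ?_
    filter_upwards [φ.coeFn_toLp 2 (volume : Measure R3)] with x hx
    rw [hx]
    calc ‖V x‖ₑ * ‖φ x‖ₑ ^ 2 ≤ ‖V x‖ₑ * (ENNReal.ofReal C * radialWeight x) ^ 2 := by
          gcongr; exact hC x
      _ = _ := by ring
  · rw [lintegral_const_mul' _ _ (by simp)]
    exact ENNReal.mul_lt_top (by simp) hV.lintegral_mul_radialWeight_sq_lt_top

theorem laplacianH2_schwartz (φ : 𝓢(R3, ℂ)) :
    laplacianH2 ⟨φ.toLp 2 (volume : Measure R3), schwartz_mem_sobolevH2 φ⟩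
      = (Δ φ).toLp 2 (volume : Measure R3) := by
  apply toTemperedDistribution_injective_L2R3
  simp only [Lp.toTemperedDistributionCLM_apply]
  rw [← laplacianH2_spec]
  simp only [Lp.toTemperedDistribution_toLp_eq,
    TemperedDistribution.laplacian_toTemperedDistributionCLM_eq]

/-- The complex conjugate of a Schwartz function. -/
def schwartzConj (φ : 𝓢(R3, ℂ)) : 𝓢(R3, ℂ) :=
  SchwartzMap.postcompCLM (𝕜 := ℝ) (Complex.conjCLE : ℂ →L[ℝ] ℂ) φ

theorem schwartzConj_apply (φ : 𝓢(R3, ℂ)) (x : R3) : schwartzConj φ x = conj (φ x) := rfl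

theorem laplacian_schwartzConj (φ : 𝓢(R3, ℂ)) :
    Δ (schwartzConj φ) = schwartzConj (Δ φ) := by
  ext x
  rw [SchwartzMap.laplacian_apply, schwartzConj_apply, SchwartzMap.laplacian_apply]
  have h := (φ.contDiffAt 2 (x := x)).laplacian_CLM_comp_left (l := (Complex.conjCLE : ℂ →L[ℝ] ℂ))
  exact h

theorem inner_schwartz_toLp (φ : 𝓢(R3, ℂ)) (ψ : L2R3) :
    inner ℂ (φ.toLp 2 (volume : Measure R3)) ψ = ∫ x, conj (φ x) * ψ x := by
  rw [L2.inner_def]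
  refine integral_congr_ae ?_
  filter_upwards [φ.coeFn_toLp 2 (volume : Measure R3)] with x hx
  rw [hx, RCLike.inner_apply, mul_comm]

/-- The distributional pairing is bilinear while the inner product is sesquilinear, so the
distribution is evaluated at the conjugate of `φ`. -/
theorem inner_laplacian_schwartz (φ : 𝓢(R3, ℂ)) (ψ : sobolevH2) :
    inner ℂ (φ.toLp 2 (volume : Measure R3)) (laplacianH2 ψ)
      = inner ℂ ((Δ φ).toLp 2 (volume : Measure R3)) (ψ : L2R3) := by
  have h := DFunLike.congr_fun (laplacianH2_spec ψ) (schwartzConj φ)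
  rw [TemperedDistribution.laplacian_apply_apply, laplacian_schwartzConj,
    Lp.toTemperedDistribution_apply, Lp.toTemperedDistribution_apply] at h
  rw [inner_schwartz_toLp, inner_schwartz_toLp]
  exact h.symm

/-- The resolvent identity for an eigenfunction, tested against a Schwartz function. -/
theorem MemRollnik.inner_schwartz_eigenfunction {V : R3 → ℂ} (hV : MemRollnik V) {z w : ℂ}
    (hw : w.im ≠ 0) {ψ : L2R3} (h : (ψ, z • ψ) ∈ operatorGraph V hV.locallyIntegrable)
    (χ : 𝓢(R3, ℂ)) :
    inner ℂ (χ.toLp 2 (volume : Measure R3)) ψ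
      = (z - conj w) * inner ℂ ((schwartzResolvent w χ).toLp 2 (volume : Measure R3)) ψ
        - ∫ x, conj (schwartzResolvent w χ x) * V x * ψ x := by
  obtain ⟨hψ, heq⟩ := h
  set φ := schwartzResolvent w χ with hφ
  have h1 := heq ⟨_, hV.schwartz_mem_formDomain φ⟩
  simp only [perturbedForm, biharmonicForm, inner_smul_right] at h1
  rw [laplacianH2_schwartz, inner_laplacian_schwartz] at h1
  have h2 : (Δ (Δ φ)).toLp 2 (volume : Measure R3)
      = χ.toLp 2 volume + w • φ.toLp 2 (volume : Measure R3) := by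
    have h3 : Δ (Δ φ) = χ + w • φ := by
      rw [← sub_eq_iff_eq_add]
      exact laplacian_laplacian_schwartzResolvent hw χ
    rw [h3]
    exact (map_add (SchwartzMap.toLpCLM ℂ ℂ 2 (volume : Measure R3)) _ _).trans
      (by rw [map_smul]; rfl)
  have h4 : potentialForm V (φ.toLp 2 (volume : Measure R3)) ψ
      = ∫ x, conj (φ x) * V x * ψ x := by
    refine integral_congr_ae ?_
    filter_upwards [φ.coeFn_toLp 2 (volume : Measure R3)] with x hx
    rw [hx]
  rw [h2, h4, inner_add_left, inner_smul_left] at h1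
  linear_combination h1

/-! ### Passing to the limit in the spectral parameter. -/

theorem norm_resolventSymbol_le {w : ℂ} (hw : w.im ≠ 0) (ξ : R3) :
    ‖resolventSymbol w ξ‖ ≤ |w.im|⁻¹ := by
  rw [resolventSymbol, norm_inv]
  have := Complex.abs_im_le_norm ((((2 * Real.pi * ‖ξ‖) ^ 4 : ℝ) : ℂ) - w)
  simp only [Complex.sub_im, Complex.ofReal_im, zero_sub, abs_neg] at this
  gcongr

theorem ae_symbol_ne (z : ℂ) : ∀ᵐ ξ : R3, (((2 * Real.pi * ‖ξ‖) ^ 4 : ℝ) : ℂ) - z ≠ 0 := by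
  by_cases h : ∃ ξ₀ : R3, (((2 * Real.pi * ‖ξ₀‖) ^ 4 : ℝ) : ℂ) - z = 0
  · obtain ⟨ξ₀, h₀⟩ := h
    refine measure_mono_null (fun ξ hξ ↦ ?_)
      (Measure.addHaar_sphere (volume : Measure R3) (0 : R3) ‖ξ₀‖)
    simp only [ne_eq, mem_compl_iff, mem_ofPred_eq, not_not] at hξ
    have h1 : (2 * Real.pi * ‖ξ‖) ^ 4 = (2 * Real.pi * ‖ξ₀‖) ^ 4 := by
      have := (sub_eq_zero.mp hξ).trans (sub_eq_zero.mp h₀).symm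
      exact_mod_cast this
    have h2 := (pow_left_inj₀ (by positivity) (by positivity) (by norm_num)).mp h1
    have h3 := mul_left_cancel₀ (by positivity) h2
    simpa using h3
  · push Not at h
    exact ae_of_all _ h

theorem inner_schwartzResolvent {w : ℂ} (hw : w.im ≠ 0) (χ : 𝓢(R3, ℂ)) (ψ : L2R3) :
    inner ℂ ((schwartzResolvent w χ).toLp 2 (volume : Measure R3)) ψ
      = ∫ ξ, conj (resolventSymbol w ξ) * (conj ((𝓕 χ) ξ) * (𝓕 ψ : L2R3) ξ) := by
  rw [← Lp.inner_fourier_eq, SchwartzMap.toLp_fourier_eq, inner_schwartz_toLp]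
  refine integral_congr_ae (ae_of_all _ fun ξ ↦ ?_)
  simp only [fourier_schwartzResolvent hw, map_mul]
  ring

theorem continuous_resolventSymbol {w : ℂ} (hw : w.im ≠ 0) : Continuous (resolventSymbol w) := by
  unfold resolventSymbol
  exact Continuous.inv₀ (by fun_prop) fun ξ ↦ ofReal_sub_ne_zero hw _

/-- Dominated convergence: `|z - conj w| ≤ |Im w|` offsets the symbol bound `|Im w|⁻¹`, so `|a|`
dominates. Off the null set where `(2π|ξ|)⁴ = conj z`, the symbol converges while the prefactor
tends to zero. -/
theorem tendsto_integral_resolventSymbol {z : ℂ} {w : ℕ → ℂ}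
    (hw : Tendsto w atTop (𝓝 (conj z))) (him : ∀ n, (w n).im ≠ 0)
    (hle : ∀ n, ‖z - conj (w n)‖ ≤ |(w n).im|) {a : R3 → ℂ} (ha : Integrable a) :
    Tendsto (fun n ↦ ∫ ξ, (z - conj (w n)) * (conj (resolventSymbol (w n) ξ) * a ξ)) atTop
      (𝓝 0) := by
  have hsub : Tendsto (fun n ↦ z - conj (w n)) atTop (𝓝 0) := by
    have h := ((Complex.continuous_conj.tendsto _).comp hw).const_sub z
    rw [Complex.conj_conj, sub_self] at h
    exact h
  have h := tendsto_integral_of_dominated_convergence (μ := (volume : Measure R3))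
    (F := fun n ξ ↦ (z - conj (w n)) * (conj (resolventSymbol (w n) ξ) * a ξ))
    (f := fun _ ↦ (0 : ℂ)) (fun ξ ↦ ‖a ξ‖) (fun n ↦ ?_) ha.norm (fun n ↦ ?_) ?_
  · rwa [integral_zero] at h
  · have hc : Continuous fun ξ ↦ conj (resolventSymbol (w n) ξ) :=
      Complex.continuous_conj.comp (continuous_resolventSymbol (him n))
    exact (hc.aestronglyMeasurable.mul ha.aestronglyMeasurable).const_mul _
  · refine ae_of_all _ fun ξ ↦ ?_
    rw [← mul_assoc, norm_mul]
    refine mul_le_of_le_one_left (norm_nonneg _) ?_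
    rw [norm_mul, RCLike.norm_conj]
    calc _ ≤ |(w n).im| * |(w n).im|⁻¹ := by
          gcongr
          · exact hle n
          · exact norm_resolventSymbol_le (him n) ξ
      _ = 1 := mul_inv_cancel₀ (abs_ne_zero.mpr (him n))
  · filter_upwards [ae_symbol_ne (conj z)] with ξ hξ
    have h0 : Tendsto (fun n ↦ resolventSymbol (w n) ξ) atTop
        (𝓝 (((((2 * Real.pi * ‖ξ‖) ^ 4 : ℝ) : ℂ) - conj z)⁻¹)) := (hw.const_sub _).inv₀ hξ
    have h1 := (Complex.continuous_conj.tendsto _).comp h0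
    have h2 := hsub.mul (h1.mul_const (a ξ))
    rw [zero_mul] at h2
    exact h2

theorem tendsto_sub_mul_inner_schwartzResolvent {z : ℂ} {w : ℕ → ℂ}
    (hw : Tendsto w atTop (𝓝 (conj z))) (him : ∀ n, (w n).im ≠ 0)
    (hle : ∀ n, ‖z - conj (w n)‖ ≤ |(w n).im|) (χ : 𝓢(R3, ℂ)) (ψ : L2R3) :
    Tendsto (fun n ↦ (z - conj (w n)) *
      inner ℂ ((schwartzResolvent (w n) χ).toLp 2 (volume : Measure R3)) ψ) atTop (𝓝 0) := by
  have hint : Integrable (fun ξ ↦ conj ((𝓕 χ) ξ) * (𝓕 ψ : L2R3) ξ) := by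
    refine (L2.integrable_inner (𝕜 := ℂ) ((𝓕 χ).toLp 2 (volume : Measure R3)) (𝓕 ψ)).congr ?_
    filter_upwards [(𝓕 χ).coeFn_toLp 2 (volume : Measure R3)] with x hx
    rw [hx, RCLike.inner_apply, mul_comm]
  refine (tendsto_integral_resolventSymbol hw him hle hint).congr fun n ↦ ?_
  rw [inner_schwartzResolvent (him n), ← integral_const_mul]

/-- Every complex number is a limit of nonreal numbers of at least the same modulus,
approached vertically away from the real axis. -/
theorem exists_seq_nonreal (z : ℂ) : ∃ w : ℕ → ℂ, Tendsto w atTop (𝓝 (conj z)) ∧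
    (∀ n, (w n).im ≠ 0) ∧ (∀ n, ‖z - conj (w n)‖ ≤ |(w n).im|) ∧ ∀ n, ‖z‖ ≤ ‖w n‖ := by
  -- `s` is the sign of `Im z`, with either choice for real `z`; moving by `isε` then increases both
  -- `|Im z|` and `|z|`.
  obtain ⟨s, hs, hsz⟩ : ∃ s : ℝ, |s| = 1 ∧ 0 ≤ s * z.im := by
    rcases le_total 0 z.im with h | h
    · exact ⟨1, by simp, by simpa using h⟩
    · exact ⟨-1, by simp, by simpa using h⟩
  have hs2 : s ^ 2 = 1 := by rw [← sq_abs, hs, one_pow]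
  let ε : ℕ → ℝ := fun n ↦ 1 / ((n : ℝ) + 1)
  have hε (n) : 0 < ε n := by positivity
  have him (n) : ε n ≤ |z.im + s * ε n| := by
    have h1 : |s * (z.im + s * ε n)| = |z.im + s * ε n| := by rw [abs_mul, hs, one_mul]
    have h2 : s * (z.im + s * ε n) = s * z.im + ε n := by linear_combination ε n * hs2
    rw [← h1, h2]
    exact (by linarith : ε n ≤ s * z.im + ε n).trans (le_abs_self _)
  refine ⟨fun n ↦ conj (z + (s * ε n : ℝ) * Complex.I), ?_, fun n ↦ ?_, fun n ↦ ?_, fun n ↦ ?_⟩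
  · refine (Complex.continuous_conj.tendsto _).comp ?_
    have h0 : Tendsto ε atTop (𝓝 0) := tendsto_one_div_add_atTop_nhds_zero_nat
    have h1 : Tendsto (fun n ↦ ((s * ε n : ℝ) : ℂ)) atTop (𝓝 ((s * 0 : ℝ) : ℂ)) :=
      (Complex.continuous_ofReal.tendsto _).comp (h0.const_mul s)
    have h2 := (h1.mul_const Complex.I).const_add z
    simpa using h2
  · have := (hε n).trans_le (him n)
    rw [abs_pos] at this
    simp only [Complex.conj_im, Complex.add_im, Complex.mul_im, Complex.ofReal_re, Complex.I_im,
      Complex.ofReal_im, Complex.I_re, mul_one, mul_zero, add_zero]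
    exact neg_ne_zero.mpr this
  · have h1 : ‖z - conj (conj (z + (s * ε n : ℝ) * Complex.I))‖ = ε n := by
      rw [Complex.conj_conj, sub_add_cancel_left, norm_neg, norm_mul, Complex.norm_real,
        Complex.norm_I, mul_one, Real.norm_eq_abs, abs_mul, hs, one_mul, abs_of_pos (hε n)]
    rw [h1]
    simp only [Complex.conj_im, Complex.add_im, Complex.mul_im, Complex.ofReal_re, Complex.I_im,
      Complex.ofReal_im, Complex.I_re, mul_one, mul_zero, add_zero, abs_neg]
    exact him n
  · rw [RCLike.norm_conj, Complex.norm_def, Complex.norm_def]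
    apply Real.sqrt_le_sqrt
    simp only [Complex.normSq_apply, Complex.add_re, Complex.add_im, Complex.mul_im,
      Complex.mul_re, Complex.ofReal_re, Complex.I_im, Complex.ofReal_im, Complex.I_re, mul_one,
      mul_zero, add_zero, sub_zero]
    have h1 : 0 ≤ (s * z.im) * ε n := mul_nonneg hsz (hε n).le
    nlinarith [sq_nonneg (s * ε n)]

/-! ### From tested inequalities to a pointwise bound on the eigenfunction. -/

/-- A locally integrable function that is dominated by `g` when tested against Schwartz functions
is dominated by `g` almost everywhere. -/
theorem ae_norm_le_of_forall_schwartz {f : R3 → ℂ} (hf : LocallyIntegrable f) {g : R3 → ℝ}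
    (hg : LocallyIntegrable g)
    (h : ∀ χ : 𝓢(R3, ℂ), ‖∫ x, conj (χ x) * f x‖ ≤ ∫ x, ‖χ x‖ * g x) :
    ∀ᵐ x, ‖f x‖ ≤ g x := by
  -- The radii shrink to zero in the fixed ratio 2, as Lebesgue differentiation along bump functions
  -- requires.
  let φ : ℕ → ContDiffBump (0 : R3) := fun n ↦
    ⟨1 / ((n : ℝ) + 1), 2 * (1 / ((n : ℝ) + 1)), by positivity, by
      have : 0 < 1 / ((n : ℝ) + 1) := by positivity
      linarith⟩
  have hφ : Tendsto (fun n ↦ (φ n).rOut) atTop (𝓝 0) := by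
    have := (tendsto_one_div_add_atTop_nhds_zero_nat (𝕜 := ℝ)).const_mul 2
    rwa [mul_zero] at this
  have hφ' : ∀ᶠ n in atTop, (φ n).rOut ≤ 2 * (φ n).rIn := Eventually.of_forall fun n ↦ le_rfl
  filter_upwards [ContDiffBump.ae_convolution_tendsto_right_of_locallyIntegrable hφ hφ' hf,
    ContDiffBump.ae_convolution_tendsto_right_of_locallyIntegrable hφ hφ' hg] with x hx1 hx2
  refine le_of_tendsto_of_tendsto' hx1.norm hx2 fun n ↦ ?_
  let η : R3 → ℂ := fun t ↦ (((φ n).normed volume (x - t) : ℝ) : ℂ)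
  have hη1 : HasCompactSupport η := by
    have h1 : HasCompactSupport (fun t ↦ (φ n).normed volume (x - t)) :=
      (φ n).hasCompactSupport_normed.comp_homeomorph (Homeomorph.subLeft x)
    exact h1.comp_left (g := ((↑) : ℝ → ℂ)) Complex.ofReal_zero
  have hη2 : ContDiff ℝ ((⊤ : ℕ∞) : WithTop ℕ∞) η :=
    Complex.ofRealCLM.contDiff.comp ((φ n).contDiff_normed.comp (contDiff_const.sub contDiff_id))
  have hχ := h (hη1.toSchwartzMap hη2)
  simp only [convolution_eq_swap, ContinuousLinearMap.lsmul_apply]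
  refine (le_of_eq ?_).trans (hχ.trans_eq ?_)
  · congr 1
    refine integral_congr_ae (ae_of_all _ fun t ↦ ?_)
    simp [η]
  · refine integral_congr_ae (ae_of_all _ fun t ↦ ?_)
    simp [η, abs_of_nonneg ((φ n).nonneg_normed _)]

/-- The potential of the density `‖V‖ ‖ψ‖` with respect to the kernel majorant. -/
def majorantPotential (κ : ℝ) (V ψ : R3 → ℂ) (y : R3) : ℝ≥0∞ :=
  ∫⁻ x, ENNReal.ofReal (greenMajorant κ ‖x - y‖) * (‖V x‖ₑ * ‖ψ x‖ₑ)

theorem measurable_greenMajorant (κ : ℝ) : Measurable (greenMajorant κ) := by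
  unfold greenMajorant
  fun_prop

theorem ofReal_greenMajorant_le_div {κ : ℝ} (hκ : 0 < κ) (x y : R3) :
    ENNReal.ofReal (greenMajorant κ ‖x - y‖)
      ≤ ENNReal.ofReal (√2 / (8 * Real.pi * κ ^ 2)) * ‖x - y‖ₑ⁻¹ := by
  have hpi := Real.pi_pos
  have hc : ENNReal.ofReal (√2 / (8 * Real.pi * κ ^ 2)) ≠ 0 := by
    simp only [ne_eq, ENNReal.ofReal_eq_zero, not_le]
    positivity
  rcases eq_or_ne x y with rfl | h
  · simp [hc]
  have hr : 0 < ‖x - y‖ := norm_pos_iff.mpr (sub_ne_zero.mpr h)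
  rw [← ofReal_norm, ← ENNReal.ofReal_inv_of_pos hr, ← ENNReal.ofReal_mul (by positivity)]
  refine ENNReal.ofReal_le_ofReal ?_
  calc greenMajorant κ ‖x - y‖ ≤ √2 / (8 * Real.pi) * (1 / (κ ^ 2 * ‖x - y‖)) := by
        unfold greenMajorant
        gcongr
        exact min_le_right _ _
    _ = _ := by field_simp

theorem exists_greenMajorant_le_radialWeight {κ : ℝ} (hκ : 0 < κ) :
    ∃ C : ℝ, ∀ x y : R3, ENNReal.ofReal (greenMajorant κ ‖x - y‖)
      ≤ ENNReal.ofReal (C * (1 + ‖y‖)) * radialWeight x := by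
  have hpi := Real.pi_pos
  refine ⟨√2 / (8 * Real.pi) * (1 / κ + 1 / κ ^ 2), fun x y ↦ ?_⟩
  rw [radialWeight, ← ENNReal.ofReal_mul (by positivity)]
  refine ENNReal.ofReal_le_ofReal ?_
  rw [← div_eq_mul_inv, le_div_iff₀ (by positivity)]
  have h0 := greenMajorant_nonneg hκ (norm_nonneg (x - y))
  have h1 : 1 + ‖x‖ ≤ (1 + ‖x - y‖) * (1 + ‖y‖) := by
    have : ‖x‖ ≤ ‖x - y‖ + ‖y‖ := norm_le_norm_sub_add x y
    nlinarith [mul_nonneg (norm_nonneg (x - y)) (norm_nonneg y)]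
  calc _ ≤ greenMajorant κ ‖x - y‖ * ((1 + ‖x - y‖) * (1 + ‖y‖)) := by gcongr
    _ = greenMajorant κ ‖x - y‖ * (1 + ‖x - y‖) * (1 + ‖y‖) := by ring
    _ ≤ _ := mul_le_mul_of_nonneg_right (greenMajorant_mul_le hκ (norm_nonneg (x - y)))
      (by positivity)

theorem ENNReal.mul_le_sq_add_sq (a b : ℝ≥0∞) : a * b ≤ a ^ 2 + b ^ 2 := by
  rcases le_total a b with h | h
  · calc a * b ≤ b * b := by gcongr
      _ = b ^ 2 := (sq b).symm
      _ ≤ _ := le_add_self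
  · calc a * b ≤ a * a := by gcongr
      _ = a ^ 2 := (sq a).symm
      _ ≤ _ := le_self_add

theorem MemRollnik.lintegral_mul_radialWeight_lt_top {V : R3 → ℂ} (hV : MemRollnik V) {ψ : R3 → ℂ}
    (hψ : ∫⁻ x, ‖V x‖ₑ * ‖ψ x‖ₑ ^ 2 < ∞) :
    ∫⁻ x, radialWeight x * (‖V x‖ₑ * ‖ψ x‖ₑ) < ∞ := by
  have hm : AEMeasurable (fun x ↦ ‖V x‖ₑ * radialWeight x ^ 2) :=
    hV.locallyIntegrable.aestronglyMeasurable.enorm.mul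
      (measurable_radialWeight.pow_const 2).aemeasurable
  refine lt_of_le_of_lt ?_
    (ENNReal.add_lt_top.mpr ⟨hV.lintegral_mul_radialWeight_sq_lt_top, hψ⟩)
  rw [← lintegral_add_left' hm]
  refine lintegral_mono fun x ↦ ?_
  calc radialWeight x * (‖V x‖ₑ * ‖ψ x‖ₑ) = ‖V x‖ₑ * (radialWeight x * ‖ψ x‖ₑ) := by ring
    _ ≤ ‖V x‖ₑ * (radialWeight x ^ 2 + ‖ψ x‖ₑ ^ 2) := by
      gcongr
      exact ENNReal.mul_le_sq_add_sq _ _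
    _ = _ := by ring

/-- Linear growth makes the potential locally integrable and its product with any Schwartz function
integrable, as the passage to a pointwise bound requires. -/
theorem MemRollnik.exists_majorantPotential_le {V : R3 → ℂ} (hV : MemRollnik V) {ψ : R3 → ℂ}
    (hψ : ∫⁻ x, ‖V x‖ₑ * ‖ψ x‖ₑ ^ 2 < ∞) {κ : ℝ} (hκ : 0 < κ) :
    ∃ C : ℝ, ∀ y, majorantPotential κ V ψ y ≤ ENNReal.ofReal (C * (1 + ‖y‖)) := by
  obtain ⟨C, hC⟩ := exists_greenMajorant_le_radialWeight hκ
  have hJ := hV.lintegral_mul_radialWeight_lt_top hψ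
  set J := ∫⁻ x, radialWeight x * (‖V x‖ₑ * ‖ψ x‖ₑ)
  refine ⟨C * J.toReal, fun y ↦ ?_⟩
  calc majorantPotential κ V ψ y
      ≤ ∫⁻ x, ENNReal.ofReal (C * (1 + ‖y‖)) * (radialWeight x * (‖V x‖ₑ * ‖ψ x‖ₑ)) := by
        refine lintegral_mono fun x ↦ ?_
        rw [← mul_assoc (ENNReal.ofReal (C * (1 + ‖y‖)))]
        exact mul_le_mul_left (hC x y) _
    _ = ENNReal.ofReal (C * (1 + ‖y‖)) * J := lintegral_const_mul' _ _ ENNReal.ofReal_ne_top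
    _ = _ := by
        rw [← ENNReal.ofReal_toReal hJ.ne, ← ENNReal.ofReal_mul' ENNReal.toReal_nonneg,
          ENNReal.toReal_ofReal ENNReal.toReal_nonneg]
        ring_nf

theorem aemeasurable_majorant_kernel {V ψ : R3 → ℂ} (hV : AEStronglyMeasurable V)
    (hψ : AEStronglyMeasurable ψ) (κ : ℝ) :
    AEMeasurable (fun p : R3 × R3 ↦
      ENNReal.ofReal (greenMajorant κ ‖p.1 - p.2‖) * (‖V p.1‖ₑ * ‖ψ p.1‖ₑ))
      ((volume : Measure R3).prod volume) := by
  have h1 : Measurable fun p : R3 × R3 ↦ ENNReal.ofReal (greenMajorant κ ‖p.1 - p.2‖) :=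
    ((measurable_greenMajorant κ).comp (by fun_prop)).ennreal_ofReal
  exact h1.aemeasurable.mul ((hV.enorm.mul hψ.enorm).comp_fst)

theorem aemeasurable_majorantPotential {V ψ : R3 → ℂ} (hV : AEStronglyMeasurable V)
    (hψ : AEStronglyMeasurable ψ) (κ : ℝ) : AEMeasurable (majorantPotential κ V ψ) :=
  (aemeasurable_majorant_kernel hV hψ κ).prod_swap.lintegral_prod_right'

theorem lintegral_schwartz_majorantPotential {V ψ : R3 → ℂ} (hV : AEStronglyMeasurable V)
    (hψ : AEStronglyMeasurable ψ) (κ : ℝ) (χ : 𝓢(R3, ℂ)) :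
    ∫⁻ x, (∫⁻ y, ENNReal.ofReal (greenMajorant κ ‖x - y‖) * ‖χ y‖ₑ) * (‖V x‖ₑ * ‖ψ x‖ₑ)
      = ∫⁻ y, ‖χ y‖ₑ * majorantPotential κ V ψ y := by
  have hm : Measurable fun p : R3 × R3 ↦ ‖χ p.2‖ₑ :=
    (χ.continuous.measurable.comp measurable_snd).enorm
  have hmx (x : R3) : Measurable fun y ↦ ENNReal.ofReal (greenMajorant κ ‖x - y‖) * ‖χ y‖ₑ :=
    (((measurable_greenMajorant κ).comp (by fun_prop)).ennreal_ofReal).mul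
      χ.continuous.measurable.enorm
  calc _ = ∫⁻ x, ∫⁻ y, ENNReal.ofReal (greenMajorant κ ‖x - y‖) * (‖V x‖ₑ * ‖ψ x‖ₑ) * ‖χ y‖ₑ := by
        refine lintegral_congr fun x ↦ ?_
        rw [← lintegral_mul_const _ (hmx x)]
        refine lintegral_congr fun y ↦ ?_
        ring
    _ = ∫⁻ y, ∫⁻ x, ENNReal.ofReal (greenMajorant κ ‖x - y‖) * (‖V x‖ₑ * ‖ψ x‖ₑ) * ‖χ y‖ₑ :=
        lintegral_lintegral_swap ((aemeasurable_majorant_kernel hV hψ κ).mul hm.aemeasurable)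
    _ = _ := by
        refine lintegral_congr fun y ↦ ?_
        rw [majorantPotential, mul_comm, lintegral_mul_const' _ _ enorm_ne_top]

/-- An eigenfunction is dominated by the potential of `‖V‖ ‖ψ‖`, when tested against Schwartz
functions. -/
theorem MemRollnik.enorm_inner_eigenfunction_le {V : R3 → ℂ} (hV : MemRollnik V) {z : ℂ} {κ : ℝ}
    (hκ : 0 < κ) (hz : κ ^ 4 ≤ ‖z‖) {ψ : L2R3}
    (h : (ψ, z • ψ) ∈ operatorGraph V hV.locallyIntegrable) (χ : 𝓢(R3, ℂ)) :
    ‖inner ℂ (χ.toLp 2 (volume : Measure R3)) ψ‖ₑ ≤ ∫⁻ y, ‖χ y‖ₑ * majorantPotential κ V ψ y := by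
  obtain ⟨w, hw, him, hle, hnorm⟩ := exists_seq_nonreal z
  have ht := (tendsto_sub_mul_inner_schwartzResolvent hw him hle χ ψ).enorm
  rw [enorm_zero] at ht
  have ht' := ht.add_const (∫⁻ y, ‖χ y‖ₑ * majorantPotential κ V ψ y)
  rw [zero_add] at ht'
  -- The left side is independent of `n`, and the potential term is bounded uniformly because `κ⁴ ≤
  -- |z| ≤ |w n|`; only the error term varies.
  refine ge_of_tendsto' ht' fun n ↦ ?_
  rw [hV.inner_schwartz_eigenfunction (him n) h χ]
  refine enorm_sub_le.trans ?_
  gcongr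
  rw [← lintegral_schwartz_majorantPotential hV.locallyIntegrable.aestronglyMeasurable
    (Lp.aestronglyMeasurable ψ)]
  refine (enorm_integral_le_lintegral_enorm _).trans (lintegral_mono fun x ↦ ?_)
  rw [enorm_mul, enorm_mul, RCLike.enorm_conj, mul_assoc]
  gcongr
  exact enorm_schwartzResolvent_le hκ (him n) (hz.trans (hnorm n)) χ x

/-- An eigenfunction is dominated pointwise by the potential of `‖V‖ ‖ψ‖`. -/
theorem MemRollnik.enorm_eigenfunction_le {V : R3 → ℂ} (hV : MemRollnik V) {z : ℂ} {κ : ℝ}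
    (hκ : 0 < κ) (hz : κ ^ 4 ≤ ‖z‖) {ψ : L2R3}
    (h : (ψ, z • ψ) ∈ operatorGraph V hV.locallyIntegrable) :
    ∀ᵐ y, ‖ψ y‖ₑ ≤ majorantPotential κ V ψ y := by
  have hψ : ∫⁻ x, ‖V x‖ₑ * ‖ψ x‖ₑ ^ 2 < ∞ := h.1.2
  have hVm := hV.locallyIntegrable.aestronglyMeasurable
  have hψm := Lp.aestronglyMeasurable ψ
  obtain ⟨C, hC⟩ := hV.exists_majorantPotential_le hψ hκ
  have hfin (y) : majorantPotential κ V ψ y ≠ ∞ := ((hC y).trans_lt ENNReal.ofReal_lt_top).ne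
  have hNm := aemeasurable_majorantPotential hVm hψm κ
  have hle (y) : (majorantPotential κ V ψ y).toReal ≤ |C * (1 + ‖y‖)| :=
    (ENNReal.toReal_mono ENNReal.ofReal_ne_top (hC y)).trans
      (by rw [ENNReal.toReal_ofReal']; exact max_le (le_abs_self _) (abs_nonneg _))
  have hN : LocallyIntegrable (fun y ↦ (majorantPotential κ V ψ y).toReal) := by
    have hc : Continuous fun y : R3 ↦ |C * (1 + ‖y‖)| := by fun_prop
    refine hc.locallyIntegrable.mono hNm.ennreal_toReal.aestronglyMeasurable
      (ae_of_all _ fun y ↦ ?_)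
    rw [Real.norm_of_nonneg ENNReal.toReal_nonneg, Real.norm_of_nonneg (abs_nonneg _)]
    exact hle y
  have hψl : LocallyIntegrable ψ := (Lp.memLp ψ).locallyIntegrable (by norm_num)
  have key := ae_norm_le_of_forall_schwartz hψl hN fun χ ↦ ?_
  · filter_upwards [key] with y hy
    rw [← ofReal_norm, ← ENNReal.ofReal_toReal (hfin y)]
    exact ENNReal.ofReal_le_ofReal hy
  · have h1 := hV.enorm_inner_eigenfunction_le hκ hz h χ
    rw [inner_schwartz_toLp] at h1
    have h2 : ∫⁻ y, ‖χ y‖ₑ * majorantPotential κ V ψ y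
        = ∫⁻ y, ENNReal.ofReal (‖χ y‖ * (majorantPotential κ V ψ y).toReal) := by
      refine lintegral_congr fun y ↦ ?_
      rw [ENNReal.ofReal_mul (norm_nonneg _), ofReal_norm, ENNReal.ofReal_toReal (hfin y)]
    have h3 : Integrable fun y ↦ ‖χ y‖ * (majorantPotential κ V ψ y).toReal := by
      have h4 : Integrable fun y : R3 ↦ |C| * (‖χ y‖ + ‖y‖ ^ 1 * ‖χ y‖) :=
        (χ.integrable.norm.add (χ.integrable_pow_mul volume 1)).const_mul _
      refine h4.mono' (χ.continuous.norm.aestronglyMeasurable.mul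
        hNm.ennreal_toReal.aestronglyMeasurable) (ae_of_all _ fun y ↦ ?_)
      rw [Real.norm_of_nonneg (by positivity)]
      calc _ ≤ ‖χ y‖ * |C * (1 + ‖y‖)| := by gcongr; exact hle y
        _ = _ := by rw [abs_mul, abs_of_pos (by positivity : 0 < 1 + ‖y‖)]; ring
    rw [h2, ← ofReal_integral_eq_lintegral_ofReal h3 (ae_of_all _ fun y ↦ by positivity),
      ← ofReal_norm] at h1
    exact (ENNReal.ofReal_le_ofReal_iff (integral_nonneg fun y ↦ by positivity)).mp h1

/-! ### Cauchy–Schwarz and conclusion. -/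

/-- Split the integrand of the potential as `|V|^{1/2}|x - y|⁻¹` times `|V|^{1/2}|ψ|` and apply
Cauchy–Schwarz. Integrating the squared bound against `|V(y)|` produces the Rollnik integral, as in
the Hilbert–Schmidt bound for the Birman–Schwinger kernel. -/
theorem MemRollnik.lintegral_eigenfunction_le {V : R3 → ℂ} (hV : MemRollnik V) {κ : ℝ}
    (hκ : 0 < κ) {ψ : R3 → ℂ} (hψm : AEStronglyMeasurable ψ)
    (hle : ∀ᵐ y, ‖ψ y‖ₑ ≤ majorantPotential κ V ψ y) :
    ∫⁻ y, ‖V y‖ₑ * ‖ψ y‖ₑ ^ 2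
      ≤ ENNReal.ofReal (√2 / (8 * Real.pi * κ ^ 2)) ^ 2 * rollnikIntegral V
        * ∫⁻ y, ‖V y‖ₑ * ‖ψ y‖ₑ ^ 2 := by
  have hVm := hV.locallyIntegrable.aestronglyMeasurable.enorm
  set c := ENNReal.ofReal (√2 / (8 * Real.pi * κ ^ 2))
  set I := ∫⁻ y, ‖V y‖ₑ * ‖ψ y‖ₑ ^ 2
  have hsqrt (a : ℝ≥0∞) : (a ^ (1 / 2 : ℝ)) ^ (2 : ℝ) = a := by
    rw [← ENNReal.rpow_mul]; norm_num
  have hN (y : R3) : majorantPotential κ V ψ y ^ 2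
      ≤ c ^ 2 * ((∫⁻ x, ‖V x‖ₑ * (‖x - y‖ₑ ^ 2)⁻¹) * I) := by
    have h1 : majorantPotential κ V ψ y
        ≤ c * ∫⁻ x, (‖V x‖ₑ ^ (1 / 2 : ℝ) * ‖x - y‖ₑ⁻¹) * (‖V x‖ₑ ^ (1 / 2 : ℝ) * ‖ψ x‖ₑ) := by
      rw [majorantPotential, ← lintegral_const_mul' _ _ ENNReal.ofReal_ne_top]
      refine lintegral_mono fun x ↦ ?_
      have h2 : ‖V x‖ₑ = ‖V x‖ₑ ^ (1 / 2 : ℝ) * ‖V x‖ₑ ^ (1 / 2 : ℝ) := by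
        conv_lhs => rw [← hsqrt ‖V x‖ₑ]
        rw [ENNReal.rpow_two, sq]
      calc _ ≤ c * ‖x - y‖ₑ⁻¹ * (‖V x‖ₑ * ‖ψ x‖ₑ) :=
            mul_le_mul_left (ofReal_greenMajorant_le_div hκ x y) _
        _ = c * ‖x - y‖ₑ⁻¹ * (‖V x‖ₑ ^ (1 / 2 : ℝ) * ‖V x‖ₑ ^ (1 / 2 : ℝ) * ‖ψ x‖ₑ) := by rw [← h2]
        _ = _ := by ring
    have h3 := ENNReal.lintegral_mul_le_Lp_mul_Lq (volume : Measure R3) Real.HolderConjugate.two_two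
      (f := fun x ↦ ‖V x‖ₑ ^ (1 / 2 : ℝ) * ‖x - y‖ₑ⁻¹)
      (g := fun x ↦ ‖V x‖ₑ ^ (1 / 2 : ℝ) * ‖ψ x‖ₑ)
      ((hVm.pow_const _).mul (by fun_prop)) ((hVm.pow_const _).mul hψm.enorm)
    simp only [Pi.mul_apply, ENNReal.mul_rpow_of_nonneg _ _ (zero_le_two : (0 : ℝ) ≤ 2),
      hsqrt] at h3
    simp only [ENNReal.rpow_two, ← ENNReal.inv_pow] at h3
    calc _ ≤ (c * ((∫⁻ x, ‖V x‖ₑ * (‖x - y‖ₑ ^ 2)⁻¹) ^ (1 / 2 : ℝ) * I ^ (1 / 2 : ℝ))) ^ 2 := by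
          gcongr
          exact h1.trans (mul_le_mul_right h3 c)
      _ = _ := by
          rw [mul_pow, mul_pow, ← ENNReal.rpow_two (_ ^ (1 / 2 : ℝ)), hsqrt,
            ← ENNReal.rpow_two (_ ^ (1 / 2 : ℝ)), hsqrt]
  calc I ≤ ∫⁻ y, c ^ 2 * I * ∫⁻ x, ‖V y‖ₑ * ‖V x‖ₑ / ‖y - x‖ₑ ^ 2 := by
        refine lintegral_mono_ae ?_
        filter_upwards [hle] with y hy
        calc ‖V y‖ₑ * ‖ψ y‖ₑ ^ 2
            ≤ ‖V y‖ₑ * (c ^ 2 * ((∫⁻ x, ‖V x‖ₑ * (‖x - y‖ₑ ^ 2)⁻¹) * I)) := by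
              gcongr
              exact (by gcongr : ‖ψ y‖ₑ ^ 2 ≤ majorantPotential κ V ψ y ^ 2).trans (hN y)
          _ = c ^ 2 * I * (‖V y‖ₑ * ∫⁻ x, ‖V x‖ₑ * (‖x - y‖ₑ ^ 2)⁻¹) := by ring
          _ = _ := by
              rw [← lintegral_const_mul' _ _ enorm_ne_top]
              congr 2
              ext x
              rw [enorm_sub_rev, div_eq_mul_inv, mul_assoc]
    _ ≤ c ^ 2 * I * rollnikIntegral V := by
        rw [rollnikIntegral, lintegral_const_mul'']
        have hm : AEMeasurable (fun p : R3 × R3 ↦ ‖V p.1‖ₑ * ‖V p.2‖ₑ / ‖p.1 - p.2‖ₑ ^ 2)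
            ((volume : Measure R3).prod volume) :=
          (hVm.comp_fst.mul hVm.comp_snd).div (by fun_prop)
        exact hm.lintegral_prod_right'
    _ = _ := by ring

end

theorem theorem2 (V : R3 → ℂ) (hV : MemRollnik V) :
    pointSpectrum (biharmonicOperator V hV.locallyIntegrable) ⊆
      {z : ℂ | ‖z‖ ≤ 1 / 2 * (rollnikNorm V ^ 2 / (4 * Real.pi) ^ 2)} := by
  rintro z ⟨ψ, hψ0, hψ⟩
  have hpi := Real.pi_pos
  rw [Set.mem_ofPred_eq]
  rcases eq_or_ne z 0 with rfl | hz
  · rw [norm_zero]; positivity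
  have hgraph : ((ψ : L2R3), z • (ψ : L2R3)) ∈ operatorGraph V hV.locallyIntegrable := by
    rw [← graph_biharmonicOperator, ← hψ]
    exact LinearPMap.mem_graph _ ψ
  set κ := √(√‖z‖) with hκdef
  have hκ : 0 < κ := Real.sqrt_pos.mpr (Real.sqrt_pos.mpr (norm_pos_iff.mpr hz))
  have hκ2 : κ ^ 2 = √‖z‖ := Real.sq_sqrt (Real.sqrt_nonneg _)
  have hκ4 : κ ^ 4 = ‖z‖ := by
    rw [show κ ^ 4 = (κ ^ 2) ^ 2 by ring, hκ2, Real.sq_sqrt (norm_nonneg _)]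
  have hle := hV.enorm_eigenfunction_le hκ hκ4.le hgraph
  have hψm := Lp.aestronglyMeasurable (ψ : L2R3)
  have hI : ∫⁻ x, ‖V x‖ₑ * ‖(ψ : L2R3) x‖ₑ ^ 2 < ∞ := hgraph.1.2
  have hbound := hV.lintegral_eigenfunction_le hκ hψm hle
  set I := ∫⁻ x, ‖V x‖ₑ * ‖(ψ : L2R3) x‖ₑ ^ 2 with hIdef
  -- If `I = 0` then `Vψ = 0` almost everywhere, its potential vanishes identically, and so does the
  -- `ψ` it dominates.
  have hI0 : I ≠ 0 := by
    intro h0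
    apply hψ0
    have hm : AEMeasurable fun x ↦ ‖V x‖ₑ * ‖(ψ : L2R3) x‖ₑ ^ 2 :=
      hV.locallyIntegrable.aestronglyMeasurable.enorm.mul (hψm.enorm.pow_const 2)
    have hae := (lintegral_eq_zero_iff' hm).mp h0
    have hN (y) : majorantPotential κ V (ψ : L2R3) y = 0 := by
      rw [majorantPotential, lintegral_congr_ae (g := fun _ ↦ 0), lintegral_zero]
      filter_upwards [hae] with x hx
      rcases mul_eq_zero.mp hx with h | h
      · rw [h, zero_mul, mul_zero]
      · rw [(pow_eq_zero_iff two_ne_zero).mp h, mul_zero, mul_zero]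
    refine Lp.ext ?_
    filter_upwards [hle, Lp.coeFn_zero ℂ 2 (volume : Measure R3)] with y hy h0y
    rw [hN, nonpos_iff_eq_zero, enorm_eq_zero] at hy
    rw [hy, h0y, Pi.zero_apply]
  have hR : rollnikIntegral V ≠ ∞ := hV.integral_lt_top.ne
  have hnorm : rollnikNorm V ^ 2 = (rollnikIntegral V).toReal :=
    Real.sq_sqrt ENNReal.toReal_nonneg
  rw [hnorm]
  have h1 := ENNReal.toReal_mono (by finiteness) hbound
  rw [ENNReal.toReal_mul, ENNReal.toReal_mul, ENNReal.toReal_pow,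
    ENNReal.toReal_ofReal (by positivity)] at h1
  have hIpos : 0 < I.toReal := ENNReal.toReal_pos hI0 hI.ne
  -- Cancels `I`, which is positive and finite. As `κ⁴ = |z|`, the constant is `2 / (64π²|z|)`, that
  -- is `1 / (2(4π)²|z|)`.
  have h2 : 1 ≤ (√2 / (8 * Real.pi * κ ^ 2)) ^ 2 * (rollnikIntegral V).toReal := by
    by_contra hlt
    push Not at hlt
    nlinarith
  have h3 : (√2 / (8 * Real.pi * κ ^ 2)) ^ 2 = 2 / (64 * Real.pi ^ 2 * ‖z‖) := by
    rw [div_pow, Real.sq_sqrt (by norm_num), ← hκ4]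
    ring
  have hz' : 0 < ‖z‖ := norm_pos_iff.mpr hz
  rw [h3, div_mul_eq_mul_div, le_div_iff₀ (by positivity)] at h2
  rw [mul_pow, ← mul_div_assoc, le_div_iff₀ (by positivity)]
  linarith
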